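/- Let $J\ge 1$, $\kappa\in(0,1/2)$, $\mathrm{SNR}>0$, $\rho$ and $\alpha\ge 0$ be fixed reals ($J$ an integer). For each $n$ let $k=k_n\le n$ and $m=m_n$ be such that $k/n\to\kappa$ and $m/n\to\rho/J$ as $n\to\infty$. Let $S$ be uniformly distributed over the subsets of $\{1,\dots,n\}$ of size $k$; let $\mathbf X_1,\dots,\mathbf X_J\in\mathbb R^n$ vanish off $S$ and have i.i.d. $\mathcal N(0,1)$ entries on $S$; and let $\mathbf Y_j=\sqrt{\mathrm{SNR}/k}\,\mathbf A_j\mathbf X_j+\mathbf W_j$ for $j=1,\dots,J$, where the matrices $\mathbf A_j\in\mathbb R^{m\times n}$ and the noise vectors $\mathbf W_j\in\mathbb R^m$ have i.i.d. $\mathcal N(0,1)$ entries, everything being independent. The nearest-subspace estimator $\hat S$ minimizes $\sum_{j=1}^J \mathrm{dist}(\mathbf Y_j,\operatorname{span}\mathbf A_j(T))^2$ over all $T\subset\{1,\dots,n\}$ with $|T|=k$ (ties broken arbitrarily), where $\mathbf A_j(T)$ consists of the columns of $\mathbf A_j$ indexed by $T$. The distortion is $d(S,\hat S)=\frac1k\max(|S\setminus\hat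 S|,|\hat S\setminus S|)$, and $\alpha$ is achievable if $\Pr[d(S,\hat S)>\alpha]\to 0$ as $n\to\infty$ for all such sequences. With natural logarithms, let $H_b(p)=-p\log p-(1-p)\log(1-p)$; let $$R(\kappa,\beta)=H_b(\kappa)-\kappa H_b(\beta)-(1-\kappa)H_b\Big(\frac{\kappa\beta}{1-\kappa}\Big)\quad\text{if }\beta<1-\kappa,\qquad R(\kappa,\beta)=0\quad\text{otherwise};$$ and let $P_J(\beta)=\int_0^\beta \xi_J(p)\,dp$, where $\xi_J$ is the quantile function of $\frac1J\chi^2_J$, the normalized chi-square variable with $J$ degrees of freedom. **Theorem.** The distortion $\alpha$ is achievable for the nearest-subspace estimator whenever $$\rho>\kappa J+\max_{\beta\in[\alpha,1]}\min\big(E_1(\beta),E_2(\beta)\big),$$ where $$E_1(\beta)=\frac{2H_b(\kappa)-2R(\kappa,\beta)+2\beta\kappa J\log(5/3)}{\frac1J\log\big(1+\frac{4}{25}J\,P_J(\beta)\,\mathrm{SNR}\big)},$$ $$E_2(\beta)=\frac{2H_b(\kappa)-2R(\kappa,\beta)}{\log\big(1+P_1(\beta)\,\mathrm{SNR}\big)+\dfrac{1}{1+P_1(\beta)\,\mathrm{SNR}}-1}.$$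 (The maximum is read as a supremum in $[-\infty,\infty]$: it is $+\infty$ for $\alpha=0$ and $-\infty$, the supremum of the empty set, for $\alpha>1$.) -/

import Mathlib

open MeasureTheory ProbabilityTheory Filter Topology

noncomputable section

namespace SparsityRecovery

/-! ### The random model -/

/-- All the randomness of the problem, with `J` vectors of length `n` and `m` measurements of each
of them: the sparsity pattern, the values that the nonzero entries take, the measurement matrices,
and the noise. -/
abbrev Sample (n m J : ℕ) : Type :=
  Finset (Fin n) × (Fin J → Fin n → ℝ) × (Fin J → Fin m → Fin n → ℝ) × (Fin J → Fin m → ℝ)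

/-- The joint law: the sparsity pattern is uniform over the subsets of size `k`, all the other
variables are standard Gaussian, and everything is independent. -/
def law (n m J k : ℕ) : Measure (Sample n m J) :=
  (uniformOn {S : Finset (Fin n) | S.card = k}).prod
    ((Measure.pi fun _ => Measure.pi fun _ => gaussianReal 0 1).prod
      ((Measure.pi fun _ => Measure.pi fun _ => Measure.pi fun _ => gaussianReal 0 1).prod
        (Measure.pi fun _ => Measure.pi fun _ => gaussianReal 0 1)))

variable {n m J : ℕ}

/-- The sparsity pattern `S`. -/
def pattern (ω : Sample n m J) : Finset (Fin n) := ω.1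

/-- The sparse vector `X_j`: Gaussian on the sparsity pattern and zero off it. -/
def signal (ω : Sample n m J) (j : Fin J) : Fin n → ℝ :=
  fun i => if i ∈ pattern ω then ω.2.1 j i else 0

/-- The measurement matrix `A_j`. -/
def sensing (ω : Sample n m J) (j : Fin J) : Matrix (Fin m) (Fin n) ℝ :=
  Matrix.of (ω.2.2.1 j)

/-- The noise vector `W_j`. -/
def noise (ω : Sample n m J) (j : Fin J) : Fin m → ℝ := ω.2.2.2 j

/-- The measurement vector `Y_j = √(SNR / k) A_j X_j + W_j`, as a vector of the Euclidean space. -/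
def measurement (SNR : ℝ) (k : ℕ) (ω : Sample n m J) (j : Fin J) : EuclideanSpace ℝ (Fin m) :=
  WithLp.toLp 2 (Real.sqrt (SNR / k) • (sensing ω j).mulVec (signal ω j) + noise ω j)

/-! ### Estimators -/

/-- An estimator of the sparsity pattern: a function of the measurement vectors and of the
measurement matrices. -/
abbrev Estimator (n m J : ℕ) : Type :=
  (Fin J → EuclideanSpace ℝ (Fin m)) → (Fin J → Matrix (Fin m) (Fin n) ℝ) → Finset (Fin n)

/-- The distortion `d(S, T) = max (|S \ T|, |T \ S|) / k`. -/
def distortion (k : ℕ) (S T : Finset (Fin n)) : ℝ :=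
  (max (S \ T).card (T \ S).card : ℕ) / (k : ℝ)

/-- The linear span of the columns of `A` indexed by `S`. -/
def colSpan (A : Matrix (Fin m) (Fin n) ℝ) (S : Finset (Fin n)) :
    Submodule ℝ (EuclideanSpace ℝ (Fin m)) :=
  Submodule.span ℝ ((fun i : Fin n => WithLp.toLp 2 (A.col i)) '' (S : Set (Fin n)))

/-- The nearest-subspace cost `∑_j dist(Y_j, A_j(S))²`. -/
def cost (Y : Fin J → EuclideanSpace ℝ (Fin m)) (A : Fin J → Matrix (Fin m) (Fin n) ℝ)
    (S : Finset (Fin n)) : ℝ :=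
  ∑ j, Metric.infDist (Y j) (colSpan (A j) S : Set (EuclideanSpace ℝ (Fin m))) ^ 2

/-- `est` is a nearest-subspace estimator: it always returns a set of size `k` that minimizes the
cost among all sets of size `k` (ties are broken in an arbitrary way). -/
def IsNearestSubspace (k : ℕ) (est : Estimator n m J) : Prop :=
  ∀ Y A, (est Y A).card = k ∧ ∀ T : Finset (Fin n), T.card = k → cost Y A (est Y A) ≤ cost Y A T

/-- The probability that the distortion of the estimate exceeds `α`. -/
def errorProb (SNR α : ℝ) (k : ℕ) (est : Estimator n m J) : ENNReal :=
  law n m J k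
    {ω | α < distortion k (pattern ω) (est (measurement SNR k ω) (sensing ω))}

/-- The distortion `α` is achievable for the nearest-subspace estimator, at sparsity rate `κ`,
total sampling rate `ρ` and diversity `J`: whenever `k / n → κ` and `m / n → ρ / J`, the probability
that the distortion exceeds `α` tends to `0` as `n → ∞`. -/
def NearestSubspaceAchievable (κ SNR ρ : ℝ) (J : ℕ) (α : ℝ) : Prop :=
  ∀ k m : ℕ → ℕ, (∀ n, k n ≤ n) →
    Tendsto (fun n : ℕ => (k n : ℝ) / n) atTop (𝓝 κ) →
    Tendsto (fun n : ℕ => (m n : ℝ) / n) atTop (𝓝 (ρ / J)) →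
    ∀ est : (n : ℕ) → Estimator n (m n) J, (∀ n, IsNearestSubspace (k n) (est n)) →
      Tendsto (fun n => errorProb SNR α (k n) (est n)) atTop (𝓝 0)

/-! ### The quantities in the bound -/

/-- The law of `χ²_J / J`, the normalized chi-square variable with `J` degrees of freedom. -/
def normChiSq (J : ℕ) : Measure ℝ :=
  (Measure.pi fun _ : Fin J => gaussianReal 0 1).map fun z => (1 / (J : ℝ)) * ∑ j, z j ^ 2

/-- The quantile function `ξ_J` of `χ²_J / J` (only its values on `(0, 1)` matter). -/
def chiSqQuantile (J : ℕ) (p : ℝ) : ℝ :=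
  sInf {t : ℝ | p ≤ (normChiSq J).real (Set.Iic t)}

/-- The diversity power `P_J(β)`, the integral of `ξ_J` over `[0, β]`. -/
def diversityPower (J : ℕ) (β : ℝ) : ℝ := ∫ p in (0 : ℝ)..β, chiSqQuantile J p

open Classical in
/-- The metric entropy rate `R(κ, β)`; `Real.binEntropy` is the binary entropy in nats. -/
def entropyRate (κ β : ℝ) : ℝ :=
  if β < 1 - κ then
    Real.binEntropy κ - κ * Real.binEntropy β - (1 - κ) * Real.binEntropy (κ * β / (1 - κ))
  else 0

/-- The bound `E₁(β)`. -/
def E₁ (κ SNR : ℝ) (J : ℕ) (β : ℝ) : ℝ :=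
  (2 * Real.binEntropy κ - 2 * entropyRate κ β + 2 * β * κ * J * Real.log (5 / 3)) /
    ((1 / (J : ℝ)) * Real.log (1 + 4 / 25 * J * diversityPower J β * SNR))

/-- The bound `E₂(β)`. -/
def E₂ (κ SNR : ℝ) (β : ℝ) : ℝ :=
  (2 * Real.binEntropy κ - 2 * entropyRate κ β) /
    (Real.log (1 + diversityPower 1 β * SNR) + 1 / (1 + diversityPower 1 β * SNR) - 1)

end SparsityRecovery

end

/-!
# Nearest-subspace recovery of a sparsity pattern

Fix the sparsity pattern `S` and a competing pattern `T` with `|S \ T| = b`. Removing the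
contribution of the columns in `T`, the cost of `T` in channel `j` is the squared distance of
`W_j + v_j` to the span of the columns in `T`, where `v_j` combines the columns in `S \ T`; these
are Gaussian and independent of the columns in `T`, so that exponential moments of the cost are explicit
Gaussian integrals (`lintegral_exp_infDist`, `lintegral_exp_infDist_mulVec_le`). They depend on the
signal only through its power on `S \ T`.

* For `E₁` the two costs are compared directly. In the cost of `S` one may drop the columns of
  `S \ T`, and the exponential moment at `1/4` of the difference is at most
  `2 ^ (b / 2) (1 + q_j / 4) ^ (-(m - k) / 2)`, where `q_j` is the power of channel `j` on `S \ T`.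
  Multiplying over `j` and using `∏ (1 + a_j) ≥ 1 + ∑ a_j` yields `channelLaw_totalResidual_le`; the
  constants `2 ^ (1 / 2)` and `1 / 4` are better than the `5 / 3` and `4 / 25` in `E₁`.
* For `E₂` the cost of `S` is compared to its typical value `J (m - k)`
  (`channelLaw_le_totalResidual`, which needs that the `k` columns in `S` are almost surely
  independent), and the cost of `T` is bounded from below by the Chernoff bound for a chi-square
  variable (`channelLaw_totalResidual_le_const`).

The power on `S \ T` is controlled uniformly in `T`: a subset `U` of the support has energy at least
`t |U|` minus the total shortfall of the energies below the level `t`, the shortfall obeys the law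
of large numbers, and at `t = ξ_J(β)` the resulting bound is exactly `P_J(β)` (`integral_shortfall`,
`exists_measure_energy_lt_le`).

There are at most `exp (n (H_b(κ) - R(κ, β) + o(1)))` patterns at distance `β`
(`exists_pattern_rate`), so near each `β` at which the sampling rate beats `E₁` or `E₂` the union
bound decays exponentially (`exists_negligible_of_E₁`, `exists_negligible_of_E₂`), and compactness
of `[α, 1]` finishes the proof. At `α = 0` both bounds tend to infinity as `β → 0`
(`exists_lt_E₁_and_lt_E₂`), so the hypothesis fails.
-/

noncomputable section

namespace SparsityRecovery

/-! ### Gaussian integrals of distances to subspaces -/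

open Module in
/-- A chain of subspaces `U₀ ≤ U` has an adapted orthonormal basis: the distance to `U` is read off
the coordinates in `P`, the distance to `U₀` off those in `P ∪ Q`. -/
lemma exists_adapted_orthonormalBasis {E : Type*} [NormedAddCommGroup E] [InnerProductSpace ℝ E]
    [FiniteDimensional ℝ E] {U₀ U : Submodule ℝ E} (h : U₀ ≤ U) :
    ∃ (ι : Type) (_ : Fintype ι) (_ : DecidableEq ι) (b : OrthonormalBasis ι ℝ E) (P Q : Finset ι),
      Disjoint P Q ∧ P.card + finrank ℝ U = finrank ℝ E ∧ Q.card + finrank ℝ U₀ = finrank ℝ U ∧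
      (∀ x, Metric.infDist x (U : Set E) ^ 2 = ∑ i ∈ P, b.repr x i ^ 2) ∧
      (∀ x, Metric.infDist x (U₀ : Set E) ^ 2 =
        ∑ i ∈ P, b.repr x i ^ 2 + ∑ i ∈ Q, b.repr x i ^ 2) := by
  classical
  let V : Fin 3 → Submodule ℝ E := ![Uᗮ, U ⊓ U₀ᗮ, U₀]
  have h01 : ∀ x ∈ Uᗮ, ∀ y ∈ U, inner ℝ x y = 0 := fun x hx y hy =>
    Submodule.inner_left_of_mem_orthogonal hy hx
  have h12 : ∀ x ∈ U₀ᗮ, ∀ y ∈ U₀, inner ℝ x y = 0 := fun x hx y hy =>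
    Submodule.inner_left_of_mem_orthogonal hy hx
  have hort : OrthogonalFamily ℝ (fun i => V i) fun i => (V i).subtypeₗᵢ := by
    refine OrthogonalFamily.of_pairwise ?_
    intro i j hij
    fin_cases i <;> fin_cases j <;> first | exact absurd rfl hij | skip
    all_goals simp only [V, Submodule.isOrtho_iff_inner_eq]
    · exact fun x hx y hy => h01 x hx y hy.1
    · exact fun x hx y hy => h01 x hx y (h hy)
    · exact fun x hx y hy => by rw [real_inner_comm]; exact h01 y hy x hx.1
    · exact fun x hx y hy => h12 x hx.2 y hy
    · exact fun x hx y hy => by rw [real_inner_comm]; exact h01 y hy x (h hx)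
    · exact fun x hx y hy => by rw [real_inner_comm]; exact h12 y hy.2 x hx
  have hint : DirectSum.IsInternal fun i => V i := by
    rw [hort.isInternal_iff, Submodule.eq_bot_iff]
    intro x hx
    have hle : ∀ i, V i ≤ iSup V := le_iSup V
    have hx' : ∀ i, ∀ y ∈ V i, inner ℝ y x = 0 := fun i y hy =>
      (Submodule.mem_orthogonal _ _).1 hx y (hle i hy)
    have hxU : x ∈ U := by
      rw [← Submodule.orthogonal_orthogonal U, Submodule.mem_orthogonal]
      exact hx' 0
    have hx0 : x ∈ U₀ᗮ := (Submodule.mem_orthogonal _ _).2 (hx' 2)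
    exact inner_self_eq_zero.1 (hx' 1 x ⟨hxU, hx0⟩)
  let b := hint.collectedOrthonormalBasis hort fun i => stdOrthonormalBasis ℝ (V i)
  have hb : ∀ a, b a ∈ V a.1 := fun a => hint.collectedOrthonormalBasis_mem hort _ a
  -- the squared distance to `W`, in a basis each vector of which is in `W` or orthogonal to it
  have key : ∀ (W : Submodule ℝ E) (R : Finset (Σ i, Fin (finrank ℝ (V i)))),
      (∀ a ∈ R, b a ∈ Wᗮ) → (∀ a ∉ R, b a ∈ W) →
      ∀ x, Metric.infDist x (W : Set E) ^ 2 = ∑ i ∈ R, b.repr x i ^ 2 := by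
    intro W R h1 h2 x
    have hd : Metric.infDist x (W : Set E) = ‖x - W.starProjection x‖ := by
      rw [Submodule.starProjection_minimal, Metric.infDist_eq_iInf]
      simp only [dist_eq_norm]
      rfl
    rw [hd, ← b.sum_sq_inner_right, ← Finset.sum_subset (Finset.subset_univ R)]
    · refine Finset.sum_congr rfl fun a ha => ?_
      rw [inner_sub_right, Submodule.inner_left_of_mem_orthogonal
        (Submodule.starProjection_apply_mem W x) (h1 a ha), sub_zero, b.repr_apply_apply]
    · intro a _ ha
      rw [Submodule.inner_right_of_mem_orthogonal (h2 a ha)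
        (Submodule.sub_starProjection_mem_orthogonal x)]
      simp
  let P : Finset (Σ i, Fin (finrank ℝ (V i))) := Finset.univ.filter fun a => a.1 = 0
  let Q : Finset (Σ i, Fin (finrank ℝ (V i))) := Finset.univ.filter fun a => a.1 = 1
  have hcard : ∀ i, (Finset.univ.filter fun a : Σ i, Fin (finrank ℝ (V i)) => a.1 = i).card =
      finrank ℝ (V i) := by
    intro i
    have : (Finset.univ.filter fun a : Σ i, Fin (finrank ℝ (V i)) => a.1 = i) =
        Finset.univ.map ⟨Sigma.mk i, sigma_mk_injective⟩ := by
      ext ⟨j, c⟩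
      simp only [Finset.mem_filter, Finset.mem_univ, true_and, Finset.mem_map,
        Function.Embedding.coeFn_mk]
      constructor
      · rintro rfl; exact ⟨c, rfl⟩
      · rintro ⟨c, hc⟩; exact (congrArg Sigma.fst hc).symm
    rw [this]; simp
  have hPQ : Disjoint P Q := by
    rw [Finset.disjoint_left]
    intro a ha hb
    simp only [P, Q, Finset.mem_filter, Finset.mem_univ, true_and] at ha hb
    rw [ha] at hb; exact absurd hb (by decide)
  refine ⟨_, inferInstance, inferInstance, b, P, Q, hPQ, ?_, ?_, ?_, ?_⟩
  · rw [hcard 0, add_comm]; exact Submodule.finrank_add_finrank_orthogonal U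
  · rw [hcard 1, add_comm]
    change finrank ℝ U₀ + finrank ℝ (U ⊓ U₀ᗮ : Submodule ℝ E) = _
    rw [inf_comm]
    exact Submodule.finrank_add_inf_finrank_orthogonal h
  · refine key U P (fun a ha => ?_) (fun a ha => ?_)
    · have := hb a
      simp only [P, Finset.mem_filter, Finset.mem_univ, true_and] at ha
      rw [ha] at this; exact this
    · have := hb a
      obtain ⟨i, c⟩ := a
      fin_cases i
      · exact absurd (by simp [P]) ha
      · exact this.1
      · exact h this
  · intro x
    rw [← Finset.sum_union hPQ]
    refine key U₀ (P ∪ Q) (fun a ha => ?_) (fun a ha => ?_) x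
    · have := hb a
      obtain ⟨i, c⟩ := a
      fin_cases i
      · exact Submodule.orthogonal_le h this
      · exact this.2
      · simp [P, Q] at ha
    · have := hb a
      obtain ⟨i, c⟩ := a
      fin_cases i
      · simp [P, Q] at ha
      · simp [P, Q] at ha
      · exact this

lemma lintegral_pi_prod {ι : Type*} [Fintype ι] {X : ι → Type*} [∀ i, MeasurableSpace (X i)]
    (μ : ∀ i, Measure (X i)) [∀ i, IsProbabilityMeasure (μ i)] (f : ∀ i, X i → ENNReal)
    (hf : ∀ i, Measurable (f i)) :
    ∫⁻ x, ∏ i, f i (x i) ∂Measure.pi μ = ∏ i, ∫⁻ x, f i x ∂μ i := by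
  rw [lintegral_prod_eq_prod_lintegral_of_indepFun (μ := Measure.pi μ) Finset.univ
    (fun i (x : ∀ i, X i) => f i (x i))
    (iIndepFun_pi fun i => (hf i).aemeasurable) fun i => (hf i).comp (measurable_pi_apply i)]
  refine Finset.prod_congr rfl fun i _ => ?_
  exact (measurePreserving_eval μ i).lintegral_comp (hf i)

lemma lintegral_exp_quadratic_gaussianReal {t τ : ℝ} (h : 0 < 1 + 2 * (τ - t)) (v : ℝ) :
    ∫⁻ x, ENNReal.ofReal (Real.exp (t * x ^ 2 - τ * (x + v) ^ 2)) ∂gaussianReal 0 1 =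
      ENNReal.ofReal ((1 + 2 * (τ - t)) ^ (-(1 / 2) : ℝ) *
        Real.exp (-(τ - 2 * τ ^ 2 / (1 + 2 * (τ - t))) * v ^ 2)) := by
  set D := 1 + 2 * (τ - t) with hD
  let σ : NNReal := ⟨D⁻¹, by positivity⟩
  have hσ : σ ≠ 0 := fun h0 => (inv_pos.2 h).ne' (congrArg NNReal.toReal h0)
  rw [gaussianReal_of_var_ne_zero _ one_ne_zero,
    lintegral_withDensity_eq_lintegral_mul _ (measurable_gaussianPDF _ _) (by fun_prop)]
  set K := D ^ (-(1 / 2) : ℝ) * Real.exp (-(τ - 2 * τ ^ 2 / D) * v ^ 2) with hK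
  have hK0 : 0 ≤ K := by positivity
  -- completing the square turns the integrand into a multiple of another Gaussian density
  have : ∀ x, (gaussianPDF 0 1 * fun x => ENNReal.ofReal (Real.exp (t * x ^ 2 - τ * (x + v) ^ 2))) x
      = ENNReal.ofReal K * gaussianPDF (-2 * τ * v / D) σ x := by
    intro x
    simp only [Pi.mul_apply, gaussianPDF]
    rw [← ENNReal.ofReal_mul (gaussianPDFReal_nonneg _ _ _), ← ENNReal.ofReal_mul hK0]
    congr 1
    simp only [gaussianPDFReal, hK]
    have hs : (σ : ℝ) = D⁻¹ := rfl
    rw [hs]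
    have h1 : (√(2 * Real.pi * D⁻¹))⁻¹ = (√(2 * Real.pi))⁻¹ * √D := by
      rw [Real.sqrt_mul (by positivity), Real.sqrt_inv, mul_inv, inv_inv]
    have h2 : D ^ (-(1 / 2) : ℝ) = (√D)⁻¹ := by
      rw [Real.rpow_neg h.le, Real.sqrt_eq_rpow]
    have h3 : √D ≠ 0 := (Real.sqrt_pos.2 h).ne'
    rw [h1, h2]
    simp only [NNReal.coe_one, mul_one]
    rw [mul_assoc, ← Real.exp_add]
    have h4 : -(x - 0) ^ 2 / 2 + (t * x ^ 2 - τ * (x + v) ^ 2) =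
        -(τ - 2 * τ ^ 2 / D) * v ^ 2 + -(x - -2 * τ * v / D) ^ 2 / (2 * D⁻¹) := by
      have : D ≠ 0 := h.ne'
      field_simp
      rw [hD]; ring
    rw [h4, Real.exp_add]
    field_simp
  simp_rw [this]
  rw [lintegral_const_mul _ (measurable_gaussianPDF _ _), lintegral_gaussianPDF_eq_one _ hσ,
    mul_one]

open Module in
/-- The exponential moments of the distances of a standard Gaussian vector to a subspace and, after
a shift by `v`, to a larger subspace. -/
lemma lintegral_exp_infDist {E : Type*} [NormedAddCommGroup E] [InnerProductSpace ℝ E]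
    [FiniteDimensional ℝ E] [MeasurableSpace E] [BorelSpace E] {U₀ U : Submodule ℝ E}
    (h : U₀ ≤ U) {t τ : ℝ} (ht : 0 < 1 - 2 * t) (hτ : 0 < 1 + 2 * (τ - t)) (v : E) :
    ∫⁻ w, ENNReal.ofReal (Real.exp (t * Metric.infDist w (U₀ : Set E) ^ 2 -
        τ * Metric.infDist (w + v) (U : Set E) ^ 2)) ∂stdGaussian E =
      ENNReal.ofReal ((1 - 2 * t) ^ (-((finrank ℝ U : ℝ) - finrank ℝ U₀) / 2) *
        ((1 + 2 * (τ - t)) ^ (-((finrank ℝ E : ℝ) - finrank ℝ U) / 2) *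
        Real.exp (-(τ - 2 * τ ^ 2 / (1 + 2 * (τ - t))) *
          Metric.infDist v (U : Set E) ^ 2))) := by
  obtain ⟨ι, _, _, b, P, Q, hPQ, hP, hQ, hU, hU₀⟩ := exists_adapted_orthonormalBasis h
  have hrepr : ∀ (x : ι → ℝ) i, b.repr (∑ i, x i • b i) i = x i := by
    intro x i
    simp [map_sum, b.repr_self, Pi.single_apply]
  rw [stdGaussian_eq_map_pi_orthonormalBasis b, lintegral_map ?_ (by fun_prop)]
  swap
  · refine ENNReal.measurable_ofReal.comp (Real.measurable_exp.comp ?_)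
    have := Metric.continuous_infDist_pt (U₀ : Set E)
    have := Metric.continuous_infDist_pt (U : Set E)
    exact Continuous.measurable (by fun_prop)
  set c := τ - 2 * τ ^ 2 / (1 + 2 * (τ - t)) with hc
  set D := 1 + 2 * (τ - t) with hD
  let q : ι → ℝ → ℝ := fun i y =>
    if i ∈ P then t * y ^ 2 - τ * (y + b.repr v i) ^ 2 else if i ∈ Q then t * y ^ 2 else 0
  have hq : ∀ x : ι → ℝ, t * Metric.infDist (∑ i, x i • b i) (U₀ : Set E) ^ 2 -
      τ * Metric.infDist (∑ i, x i • b i + v) (U : Set E) ^ 2 = ∑ i, q i (x i) := by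
    intro x
    have h1 : ∑ i, q i (x i) =
        ∑ i ∈ P, (t * x i ^ 2 - τ * (x i + b.repr v i) ^ 2) + ∑ i ∈ Q, t * x i ^ 2 := by
      have hsub : ∀ i ∉ P ∪ Q, q i (x i) = 0 := by
        intro i hi
        rw [Finset.mem_union, not_or] at hi
        simp [q, hi.1, hi.2]
      rw [← Finset.sum_subset (Finset.subset_univ (P ∪ Q)) fun i _ hi => hsub i hi,
        Finset.sum_union hPQ]
      congr 1
      · exact Finset.sum_congr rfl fun i hi => by simp [q, hi]
      · refine Finset.sum_congr rfl fun i hi => ?_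
        have : i ∉ P := fun h' => Finset.disjoint_left.1 hPQ h' hi
        simp [q, hi, this]
    rw [h1, hU, hU₀]
    simp only [map_add, PiLp.add_apply, hrepr]
    rw [Finset.sum_sub_distrib, ← Finset.mul_sum, ← Finset.mul_sum, ← Finset.mul_sum]
    ring
  simp_rw [hq, Real.exp_sum]
  have h2 : ∀ x : ι → ℝ, ENNReal.ofReal (∏ i, Real.exp (q i (x i))) =
      ∏ i, ENNReal.ofReal (Real.exp (q i (x i))) := fun x =>
    ENNReal.ofReal_prod_of_nonneg fun i _ => (Real.exp_pos _).le
  simp_rw [h2]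
  have hqm : ∀ i, Measurable (q i) := by
    intro i
    by_cases h1 : i ∈ P
    · simp only [q, h1, if_true]; fun_prop
    · by_cases h2 : i ∈ Q
      · simp only [q, h1, h2, if_true, if_false]; fun_prop
      · simp only [q, h1, h2, if_false]; fun_prop
  rw [lintegral_pi_prod _ (fun i y => ENNReal.ofReal (Real.exp (q i y)))
    (fun i => ENNReal.measurable_ofReal.comp (Real.measurable_exp.comp (hqm i)))]
  let r : ι → ℝ := fun i => if i ∈ P then D ^ (-(1 / 2) : ℝ) * Real.exp (-c * b.repr v i ^ 2)
    else if i ∈ Q then (1 - 2 * t) ^ (-(1 / 2) : ℝ) else 1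
  have hr0 : ∀ i, 0 ≤ r i := by
    intro i; simp only [r]; split_ifs <;> positivity
  have hr : ∀ i, ∫⁻ y, ENNReal.ofReal (Real.exp (q i y)) ∂gaussianReal 0 1 =
      ENNReal.ofReal (r i) := by
    intro i
    by_cases h1 : i ∈ P
    · simp only [q, r, h1, if_true]
      exact lintegral_exp_quadratic_gaussianReal hτ _
    · by_cases h2 : i ∈ Q
      · simp only [q, r, h1, h2, if_true, if_false]
        have := lintegral_exp_quadratic_gaussianReal (t := t) (τ := 0) (by linarith) 0
        simp only [zero_mul, sub_zero] at this
        rw [this]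
        congr 1
        norm_num
        ring_nf
      · simp [q, r, h1, h2]
  simp_rw [hr]
  rw [← ENNReal.ofReal_prod_of_nonneg fun i _ => hr0 i]
  congr 1
  have hsub : ∀ i ∉ P ∪ Q, r i = 1 := by
    intro i hi
    rw [Finset.mem_union, not_or] at hi
    simp [r, hi.1, hi.2]
  rw [← Finset.prod_subset (Finset.subset_univ (P ∪ Q)) fun i _ hi => hsub i hi,
    Finset.prod_union hPQ, mul_comm]
  have hQ' : ∏ i ∈ Q, r i = (1 - 2 * t) ^ (-((finrank ℝ U : ℝ) - finrank ℝ U₀) / 2) := by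
    rw [Finset.prod_congr rfl (g := fun _ => (1 - 2 * t) ^ (-(1 / 2) : ℝ)) fun i hi => ?_]
    · rw [Finset.prod_const, ← Real.rpow_natCast, ← Real.rpow_mul ht.le]
      congr 1
      have : (Q.card : ℝ) + finrank ℝ U₀ = finrank ℝ U := by exact_mod_cast hQ
      rw [← this]; ring
    · have : i ∉ P := fun h' => Finset.disjoint_left.1 hPQ h' hi
      simp [r, hi, this]
  have hP' : ∏ i ∈ P, r i = D ^ (-((finrank ℝ E : ℝ) - finrank ℝ U) / 2) *
      Real.exp (-c * Metric.infDist v (U : Set E) ^ 2) := by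
    rw [Finset.prod_congr rfl
      (g := fun i => D ^ (-(1 / 2) : ℝ) * Real.exp (-c * b.repr v i ^ 2))
      fun i hi => by simp [r, hi]]
    rw [Finset.prod_mul_distrib, Finset.prod_const, ← Real.rpow_natCast, ← Real.rpow_mul hτ.le,
      ← Real.exp_sum, hU, Finset.mul_sum]
    congr 2
    have : (P.card : ℝ) + finrank ℝ U = finrank ℝ E := by exact_mod_cast hP
    rw [← this]; ring
  rw [hQ', hP']

/-! ### Gaussian matrices -/

/-- The law of a vector of `m` independent standard Gaussian variables. -/
abbrev gaussianVec (m : ℕ) : Measure (Fin m → ℝ) := Measure.pi fun _ => gaussianReal 0 1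

/-- The law of an `m × n` matrix of independent standard Gaussian variables. -/
abbrev gaussianMat (m n : ℕ) : Measure (Fin m → Fin n → ℝ) := Measure.pi fun _ => gaussianVec n

/-- The columns of `A` indexed by `T` together with the columns of `B` off `T`. -/
def glueCols {m n : ℕ} (T : Finset (Fin n)) (A B : Fin m → Fin n → ℝ) : Fin m → Fin n → ℝ :=
  fun l i => if i ∈ T then A l i else B l i

lemma measurePreserving_pi_map₂ {ι X : Type*} [Fintype ι] [MeasurableSpace X] (ν : Measure X)
    [IsProbabilityMeasure ν] (f : ι → X × X → X)
    (hf : ∀ i, MeasurePreserving (f i) (ν.prod ν) ν) :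
    MeasurePreserving (fun p : (ι → X) × (ι → X) => fun i => f i (p.1 i, p.2 i))
      ((Measure.pi fun _ => ν).prod (Measure.pi fun _ => ν)) (Measure.pi fun _ => ν) := by
  have h1 := (measurePreserving_arrowProdEquivProdArrow X X ι (fun _ => ν) (fun _ => ν)).symm
  exact (measurePreserving_pi (fun _ => ν.prod ν) (fun _ => ν) hf).comp h1

/-- Replacing the columns off `T` by those of an independent copy does not change the law of a
Gaussian matrix. -/
lemma measurePreserving_glueCols {m n : ℕ} (T : Finset (Fin n)) :
    MeasurePreserving (fun p : (Fin m → Fin n → ℝ) × (Fin m → Fin n → ℝ) => glueCols T p.1 p.2)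
      ((gaussianMat m n).prod (gaussianMat m n)) (gaussianMat m n) := by
  have h : MeasurePreserving
      (fun p : (Fin n → ℝ) × (Fin n → ℝ) => fun i => if i ∈ T then p.1 i else p.2 i)
      ((gaussianVec n).prod (gaussianVec n)) (gaussianVec n) := by
    refine measurePreserving_pi_map₂ (gaussianReal 0 1)
      (fun i (p : ℝ × ℝ) => if i ∈ T then p.1 else p.2) fun i => ?_
    by_cases hi : i ∈ T
    · simp only [hi, if_true]; exact measurePreserving_fst
    · simp only [hi, if_false]; exact measurePreserving_snd
  exact measurePreserving_pi_map₂ (gaussianVec n)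
    (fun _ p i => if i ∈ T then p.1 i else p.2 i) fun _ => h

lemma lintegral_glueCols {m n : ℕ} (T : Finset (Fin n)) {F : (Fin m → Fin n → ℝ) → ENNReal}
    (hF : Measurable F) :
    ∫⁻ A, F A ∂gaussianMat m n =
      ∫⁻ A, ∫⁻ B, F (glueCols T A B) ∂gaussianMat m n ∂gaussianMat m n := by
  rw [← (measurePreserving_glueCols T).lintegral_comp hF, lintegral_prod]
  exact (hF.comp (measurePreserving_glueCols T).measurable).aemeasurable

lemma map_sum_mul_gaussianVec {n : ℕ} (c : Fin n → ℝ) :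
    (gaussianVec n).map (fun x => ∑ i, x i * c i) =
      (gaussianReal 0 1).map (fun y => √(∑ i, c i ^ 2) * y) := by
  let L : StrongDual ℝ (EuclideanSpace ℝ (Fin n)) :=
    InnerProductSpace.toDual ℝ _ (WithLp.toLp 2 c)
  have h1 : (fun x : Fin n → ℝ => ∑ i, x i * c i) = L ∘ WithLp.toLp 2 := by
    ext x
    simp [L, InnerProductSpace.toDual_apply_apply, PiLp.inner_apply]
  rw [h1, ← Measure.map_map L.continuous.measurable (by fun_prop), map_pi_eq_stdGaussian,
    IsGaussian.map_eq_gaussianReal, integral_strongDual_stdGaussian, variance_dual_stdGaussian]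
  have h2 : (fun y : ℝ => √(∑ i, c i ^ 2) * y) = (√(∑ i, c i ^ 2) * ·) := rfl
  rw [h2, gaussianReal_map_const_mul, mul_zero, mul_one]
  congr 1
  ext
  rw [Real.coe_toNNReal _ (sq_nonneg _), LinearIsometryEquiv.norm_map, EuclideanSpace.norm_eq]
  simp

/-- A linear combination of the columns of a Gaussian matrix is a scaled Gaussian vector. -/
lemma map_mulVec_gaussianMat {m n : ℕ} (c : Fin n → ℝ) :
    (gaussianMat m n).map (fun B => WithLp.toLp 2 ((Matrix.of B).mulVec c)) =
      (stdGaussian (EuclideanSpace ℝ (Fin m))).map (fun g => √(∑ i, c i ^ 2) • g) := by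
  have h1 : (fun B : Fin m → Fin n → ℝ => WithLp.toLp 2 ((Matrix.of B).mulVec c)) =
      WithLp.toLp 2 ∘ fun B l => ∑ i, B l i * c i := by
    ext B l
    simp [Matrix.mulVec, dotProduct]
  have h3 : ((fun g : EuclideanSpace ℝ (Fin m) => √(∑ i, c i ^ 2) • g) ∘ WithLp.toLp 2) =
      (WithLp.toLp 2 : (Fin m → ℝ) → _) ∘ fun x l => √(∑ i, c i ^ 2) * x l := by
    ext x l
    simp
  have hL : (gaussianMat m n).map
      ((WithLp.toLp 2 : (Fin m → ℝ) → EuclideanSpace ℝ (Fin m)) ∘ fun B l => ∑ i, B l i * c i) =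
      ((gaussianMat m n).map fun B l => ∑ i, B l i * c i).map (WithLp.toLp 2) :=
    (Measure.map_map (by fun_prop) (by fun_prop)).symm
  have hR : ((gaussianVec m).map (WithLp.toLp 2)).map
      (fun g : EuclideanSpace ℝ (Fin m) => √(∑ i, c i ^ 2) • g) =
      ((gaussianVec m).map fun x l => √(∑ i, c i ^ 2) * x l).map (WithLp.toLp 2) := by
    rw [Measure.map_map (by fun_prop) (by fun_prop), h3]
    exact (Measure.map_map (by fun_prop) (by fun_prop)).symm
  rw [h1, hL, ← map_pi_eq_stdGaussian, hR]
  congr 1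
  have hp1 : IsProbabilityMeasure ((gaussianVec n).map fun x => ∑ i, x i * c i) :=
    Measure.isProbabilityMeasure_map (Measurable.aemeasurable (by fun_prop))
  have hp2 : IsProbabilityMeasure ((gaussianReal 0 1).map fun y => √(∑ i, c i ^ 2) * y) :=
    Measure.isProbabilityMeasure_map (by fun_prop)
  rw [Measure.pi_map_pi (f := fun (_ : Fin m) (x : Fin n → ℝ) => ∑ i, x i * c i)
      (fun _ => Measurable.aemeasurable (by fun_prop)),
    Measure.pi_map_pi (f := fun (_ : Fin m) (y : ℝ) => √(∑ i, c i ^ 2) * y) (by fun_prop)]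
  simp_rw [map_sum_mul_gaussianVec]

/-! ### Column spans -/

section ColSpan

variable {m n : ℕ}

lemma mem_colSpan {A : Matrix (Fin m) (Fin n) ℝ} {T : Finset (Fin n)}
    {y : EuclideanSpace ℝ (Fin m)} :
    y ∈ colSpan A T ↔
      ∃ c : Fin n → ℝ, WithLp.toLp 2 (A.mulVec fun i => if i ∈ T then c i else 0) = y := by
  have key : ∀ c : Fin n → ℝ, WithLp.toLp 2 (A.mulVec fun i => if i ∈ T then c i else 0) =
      ∑ i ∈ T, c i • (WithLp.toLp 2 (A.col i) : EuclideanSpace ℝ (Fin m)) := by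
    intro c
    ext l
    simp [Matrix.mulVec, dotProduct, Finset.sum_apply, mul_comm]
  constructor
  · intro h
    obtain ⟨c, hc⟩ := (Submodule.mem_span_image_finset_iff_exists_fun ℝ).1 h
    refine ⟨fun i => if h : i ∈ T then c ⟨i, h⟩ else 0, ?_⟩
    rw [key, ← hc, ← Finset.sum_coe_sort T]
    exact Finset.sum_congr rfl fun i _ => by simp
  · rintro ⟨c, rfl⟩
    rw [key]
    exact Submodule.sum_mem _ fun i hi => Submodule.smul_mem _ _
      (Submodule.subset_span ⟨i, hi, rfl⟩)

lemma colSpan_mono (A : Matrix (Fin m) (Fin n) ℝ) {S T : Finset (Fin n)} (h : S ⊆ T) :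
    colSpan A S ≤ colSpan A T :=
  Submodule.span_mono (Set.image_mono (by exact_mod_cast h))

lemma finrank_colSpan_le (A : Matrix (Fin m) (Fin n) ℝ) (T : Finset (Fin n)) :
    Module.finrank ℝ (colSpan A T) ≤ T.card := by
  classical
  rw [colSpan, ← Finset.coe_image]
  exact (finrank_span_finset_le_card _).trans Finset.card_image_le

lemma finrank_colSpan_le_add (A : Matrix (Fin m) (Fin n) ℝ) (S T : Finset (Fin n)) :
    Module.finrank ℝ (colSpan A T) ≤ Module.finrank ℝ (colSpan A (S ∩ T)) + (T \ S).card := by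
  have h : colSpan A T ≤ colSpan A (S ∩ T) ⊔ colSpan A (T \ S) := by
    rw [colSpan, colSpan, colSpan, ← Submodule.span_union, ← Set.image_union, ← Finset.coe_union]
    refine Submodule.span_mono (Set.image_mono ?_)
    intro i hi
    have : i ∈ T := hi
    by_cases h : i ∈ S <;> simp [h, this]
  exact (Submodule.finrank_mono h).trans
    ((Submodule.finrank_add_le_finrank_add_finrank _ _).trans
      (Nat.add_le_add_left (finrank_colSpan_le _ _) _))

lemma colSpan_glueCols (T : Finset (Fin n)) (A B : Fin m → Fin n → ℝ) :
    colSpan (Matrix.of (glueCols T A B)) T = colSpan (Matrix.of A) T := by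
  unfold colSpan
  congr 1
  refine Set.image_congr fun i hi => ?_
  have : i ∈ T := hi
  congr 1
  ext l
  simp [glueCols, this, Matrix.col]

lemma mulVec_glueCols {T : Finset (Fin n)} (A B : Fin m → Fin n → ℝ) {c : Fin n → ℝ}
    (hc : ∀ i ∈ T, c i = 0) :
    (Matrix.of (glueCols T A B)).mulVec c = (Matrix.of B).mulVec c := by
  ext l
  simp only [Matrix.mulVec, dotProduct, Matrix.of_apply, glueCols]
  refine Finset.sum_congr rfl fun i _ => ?_
  by_cases h : i ∈ T
  · simp [hc i h]
  · simp [h]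

lemma infDist_add_of_mem {E : Type*} [NormedAddCommGroup E] [NormedSpace ℝ E] {U : Submodule ℝ E}
    {u : E} (hu : u ∈ U) (x : E) :
    Metric.infDist (x + u) (U : Set E) = Metric.infDist x (U : Set E) := by
  rw [Metric.infDist_eq_iInf, Metric.infDist_eq_iInf]
  refine (Equiv.subRight (⟨u, hu⟩ : U)).iInf_congr fun y => ?_
  simp only [Equiv.subRight_apply, dist_eq_norm, AddSubgroupClass.coe_sub]
  congr 1
  abel

lemma infDist_smul_eq {E : Type*} [NormedAddCommGroup E] [InnerProductSpace ℝ E]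
    [FiniteDimensional ℝ E] (U : Submodule ℝ E) (a : ℝ) (x : E) :
    Metric.infDist (a • x) (U : Set E) ^ 2 = a ^ 2 * Metric.infDist x (U : Set E) ^ 2 := by
  have hd : ∀ x, Metric.infDist x (U : Set E) = ‖x - U.starProjection x‖ := by
    intro x
    rw [Submodule.starProjection_minimal, Metric.infDist_eq_iInf]
    simp only [dist_eq_norm]
    rfl
  rw [hd, hd, map_smul, ← smul_sub, norm_smul, mul_pow, Real.norm_eq_abs, sq_abs]

/-- The distance of a vector to a column span depends on the vector and on the matrix in an upper
semicontinuous way, hence measurably. -/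
lemma measurable_infDist_colSpan (T : Finset (Fin n)) :
    Measurable fun p : EuclideanSpace ℝ (Fin m) × (Fin m → Fin n → ℝ) =>
      Metric.infDist p.1 (colSpan (Matrix.of p.2) T : Set (EuclideanSpace ℝ (Fin m))) := by
  refine measurable_of_Iio fun r => IsOpen.measurableSet ?_
  have : ((fun p : EuclideanSpace ℝ (Fin m) × (Fin m → Fin n → ℝ) =>
      Metric.infDist p.1 (colSpan (Matrix.of p.2) T : Set (EuclideanSpace ℝ (Fin m)))) ⁻¹'
        Set.Iio r) = ⋃ c : Fin n → ℝ, {p | dist p.1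
          (WithLp.toLp 2 ((Matrix.of p.2).mulVec fun i => if i ∈ T then c i else 0)) < r} := by
    ext p
    simp only [Set.mem_preimage, Set.mem_Iio, Set.mem_iUnion, Set.mem_ofPred_eq]
    rw [Metric.infDist_lt_iff ⟨0, Submodule.zero_mem _⟩]
    constructor
    · rintro ⟨y, hy, hr⟩
      obtain ⟨c, rfl⟩ := mem_colSpan.1 hy
      exact ⟨c, hr⟩
    · rintro ⟨c, hr⟩
      exact ⟨_, mem_colSpan.2 ⟨c, rfl⟩, hr⟩
  rw [this]
  refine isOpen_iUnion fun c => isOpen_lt ?_ continuous_const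
  refine continuous_fst.dist ?_
  refine (PiLp.continuous_toLp 2 _).comp ?_
  refine continuous_pi fun l => ?_
  simp only [Matrix.mulVec, dotProduct, Matrix.of_apply]
  fun_prop

lemma measurable_infDist_colSpan_comp {Ω : Type*} [MeasurableSpace Ω] (T : Finset (Fin n))
    {Y : Ω → EuclideanSpace ℝ (Fin m)} {A : Ω → Fin m → Fin n → ℝ} (hY : Measurable Y)
    (hA : Measurable A) :
    Measurable fun ω => Metric.infDist (Y ω)
      (colSpan (Matrix.of (A ω)) T : Set (EuclideanSpace ℝ (Fin m))) :=
  by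
  have h := (measurable_infDist_colSpan (m := m) T).comp (hY.prodMk hA)
  simpa only [Function.comp_def] using h

lemma measurable_mulVec_toLp {Ω : Type*} [MeasurableSpace Ω] {A : Ω → Fin m → Fin n → ℝ}
    {c : Ω → Fin n → ℝ} (hA : Measurable A) (hc : Measurable c) :
    Measurable fun ω => (Matrix.of (A ω)).mulVec (c ω) := by
  refine measurable_pi_lambda _ fun l => ?_
  simp only [Matrix.mulVec, dotProduct, Matrix.of_apply]
  fun_prop

/-- The exponential moments of the distance of a combination of columns to the span of the
others. -/
lemma lintegral_exp_infDist_mulVec_le (T : Finset (Fin n)) {c : Fin n → ℝ}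
    (hc : ∀ i ∈ T, c i = 0) {s : ℝ} (hs : 0 ≤ s) :
    ∫⁻ A, ENNReal.ofReal (Real.exp (-s * Metric.infDist
        (WithLp.toLp 2 ((Matrix.of A).mulVec c)) (colSpan (Matrix.of A) T : Set _) ^ 2))
        ∂gaussianMat m n ≤
      ENNReal.ofReal ((1 + 2 * s * ∑ i, c i ^ 2) ^ (-((m : ℝ) - T.card) / 2)) := by
  have hmv : Measurable fun A : Fin m → Fin n → ℝ =>
      (WithLp.toLp 2 ((Matrix.of A).mulVec c) : EuclideanSpace ℝ (Fin m)) :=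
    (WithLp.measurable_toLp 2 _).comp (measurable_mulVec_toLp measurable_id measurable_const)
  rw [lintegral_glueCols T]
  swap
  · have := measurable_infDist_colSpan_comp T hmv measurable_id
    simp only [id] at this
    fun_prop
  have hσ : 0 ≤ ∑ i, c i ^ 2 := Finset.sum_nonneg fun i _ => sq_nonneg _
  refine (lintegral_mono (g := fun _ => ENNReal.ofReal
    ((1 + 2 * s * ∑ i, c i ^ 2) ^ (-((m : ℝ) - T.card) / 2))) fun A => ?_).trans (by simp)
  simp only [colSpan_glueCols, mulVec_glueCols _ _ hc]
  set U := colSpan (Matrix.of A) T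
  have hcont := Metric.continuous_infDist_pt (U : Set (EuclideanSpace ℝ (Fin m)))
  have h1 : ∫⁻ B, ENNReal.ofReal (Real.exp (-s * Metric.infDist
      (WithLp.toLp 2 ((Matrix.of B).mulVec c)) (U : Set (EuclideanSpace ℝ (Fin m))) ^ 2))
        ∂gaussianMat m n =
      ∫⁻ x, ENNReal.ofReal (Real.exp (-s * Metric.infDist x
        (U : Set (EuclideanSpace ℝ (Fin m))) ^ 2))
        ∂((gaussianMat m n).map fun B => WithLp.toLp 2 ((Matrix.of B).mulVec c)) := by
    rw [lintegral_map ?_ hmv]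
    exact ENNReal.measurable_ofReal.comp (Continuous.measurable (by fun_prop))
  rw [h1, map_mulVec_gaussianMat, lintegral_map ?_ (by fun_prop)]
  swap
  · exact ENNReal.measurable_ofReal.comp (Continuous.measurable (by fun_prop))
  simp_rw [infDist_smul_eq, Real.sq_sqrt hσ]
  have h2 := lintegral_exp_infDist (le_refl U) (t := 0) (τ := s * ∑ i, c i ^ 2) (by norm_num)
    (by have := mul_nonneg hs hσ; linarith) 0
  have h3 : Metric.infDist (0 : EuclideanSpace ℝ (Fin m)) (U : Set _) = 0 :=
    Metric.infDist_zero_of_mem U.zero_mem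
  simp only [h3, add_zero, zero_mul, zero_sub, mul_zero, sub_zero, sub_self, neg_zero, zero_div,
    Real.rpow_zero, one_mul, Real.exp_zero, mul_one, finrank_euclideanSpace, Fintype.card_fin,
    ne_eq, OfNat.ofNat_ne_zero, not_false_eq_true, zero_pow] at h2
  simp only [neg_mul, ← mul_assoc] at h2 ⊢
  rw [h2]
  refine ENNReal.ofReal_le_ofReal (Real.rpow_le_rpow_of_exponent_le ?_ ?_)
  · have := mul_nonneg hs hσ; linarith
  · have : (Module.finrank ℝ U : ℝ) ≤ T.card := by exact_mod_cast finrank_colSpan_le _ _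
    linarith

/-- At most `m` columns of a Gaussian matrix with `m` rows are almost surely independent. -/
lemma ae_linearIndepOn_col (S : Finset (Fin n)) (hS : S.card ≤ m) :
    ∀ᵐ A ∂gaussianMat m n, LinearIndepOn ℝ
      (fun i => (WithLp.toLp 2 ((Matrix.of A).col i) : EuclideanSpace ℝ (Fin m))) (S : Set _) := by
  classical
  induction S using Finset.induction_on with
  | empty => exact ae_of_all _ fun A => by simp
  | insert a S ha ih =>
    rw [Finset.card_insert_of_notMem ha] at hS
    have hcol : ∀ A : Fin m → Fin n → ℝ,
        (Matrix.of A).mulVec (Pi.single a 1) = (Matrix.of A).col a := fun A => by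
      simp
    have h0 : ∀ᵐ A ∂gaussianMat m n, Metric.infDist
        (WithLp.toLp 2 ((Matrix.of A).mulVec (Pi.single a 1)))
          (colSpan (Matrix.of A) S : Set (EuclideanSpace ℝ (Fin m))) ≠ 0 := by
      set f : (Fin m → Fin n → ℝ) → ℝ := fun A => Metric.infDist
        (WithLp.toLp 2 ((Matrix.of A).mulVec (Pi.single a 1)))
          (colSpan (Matrix.of A) S : Set (EuclideanSpace ℝ (Fin m))) with hf
      change gaussianMat m n {A | ¬ (f A ≠ 0)} = 0
      -- the probability of vanishing is at most every exponential moment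
      have hle : ∀ s : ℝ, 0 ≤ s → gaussianMat m n {A | ¬ (f A ≠ 0)} ≤
          ENNReal.ofReal ((1 + 2 * s) ^ (-(1 / 2) : ℝ)) := by
        intro s hs
        have hmv : Measurable fun A : Fin m → Fin n → ℝ =>
            (WithLp.toLp 2 ((Matrix.of A).mulVec (Pi.single a 1)) : EuclideanSpace ℝ (Fin m)) :=
          (WithLp.measurable_toLp 2 _).comp (measurable_mulVec_toLp measurable_id measurable_const)
        have hfm : Measurable f := measurable_infDist_colSpan_comp S hmv measurable_id
        have h1 := mul_meas_ge_le_lintegral (μ := gaussianMat m n)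
          (f := fun A => ENNReal.ofReal (Real.exp (-s * f A ^ 2))) (by fun_prop) 1
        rw [one_mul] at h1
        refine (measure_mono fun A hA => ?_).trans (h1.trans
          ((lintegral_exp_infDist_mulVec_le S (fun i hi => ?_) hs).trans
            (ENNReal.ofReal_le_ofReal ?_)))
        · have : f A = 0 := by simpa using hA
          simp [this]
        · exact Pi.single_eq_of_ne (ne_of_mem_of_not_mem hi ha) _
        · have h2 : ∑ i, (Pi.single a (1 : ℝ) : Fin n → ℝ) i ^ 2 = 1 := by
            simp [Pi.single_apply]
          rw [h2, mul_one]
          refine Real.rpow_le_rpow_of_exponent_le (by linarith) ?_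
          have : (S.card : ℝ) + 1 ≤ m := by exact_mod_cast hS
          linarith
      refine le_antisymm ?_ bot_le
      have hlim : Tendsto (fun s : ℝ => ENNReal.ofReal ((1 + 2 * s) ^ (-(1 / 2) : ℝ))) atTop
          (𝓝 0) := by
        rw [← ENNReal.ofReal_zero]
        refine ENNReal.tendsto_ofReal ((tendsto_rpow_neg_atTop (by norm_num)).comp ?_)
        exact tendsto_atTop_add_const_left _ _ (tendsto_id.const_mul_atTop (by norm_num))
      exact ge_of_tendsto hlim (eventually_atTop.2 ⟨0, hle⟩)
    filter_upwards [ih (by omega), h0] with A h1 h2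
    rw [Finset.coe_insert, linearIndepOn_insert (by exact_mod_cast ha)]
    refine ⟨h1, fun h => h2 ?_⟩
    rw [hcol]
    exact Metric.infDist_zero_of_mem h

lemma ae_finrank_colSpan (S : Finset (Fin n)) (hS : S.card ≤ m) :
    ∀ᵐ A ∂gaussianMat m n, Module.finrank ℝ (colSpan (Matrix.of A) S) = S.card := by
  filter_upwards [ae_linearIndepOn_col S hS] with A hA
  have := finrank_span_eq_card hA
  rw [colSpan, Set.image_eq_range]
  simpa using this

end ColSpan

/-! ### Exponential bounds on the nearest-subspace cost -/

section Cost

variable {m n : ℕ}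

/-- The measurement `A c + W` of a single vector `c`. -/
def observe (c : Fin n → ℝ) (A : Fin m → Fin n → ℝ) (W : Fin m → ℝ) :
    EuclideanSpace ℝ (Fin m) :=
  WithLp.toLp 2 ((Matrix.of A).mulVec c + W)

/-- The squared distance of the measurement `A c + W` to the span of the columns in `T`. -/
def residual (c : Fin n → ℝ) (T : Finset (Fin n)) (A : Fin m → Fin n → ℝ) (W : Fin m → ℝ) : ℝ :=
  Metric.infDist (observe c A W)
    (colSpan (Matrix.of A) T : Set (EuclideanSpace ℝ (Fin m))) ^ 2

lemma measurable_residual {Ω : Type*} [MeasurableSpace Ω] (T : Finset (Fin n))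
    {c : Ω → Fin n → ℝ} {A : Ω → Fin m → Fin n → ℝ} {W : Ω → Fin m → ℝ}
    (hc : Measurable c) (hA : Measurable A) (hW : Measurable W) :
    Measurable fun ω => residual (c ω) T (A ω) (W ω) := by
  refine (measurable_infDist_colSpan_comp T ?_ hA).pow_const 2
  exact (WithLp.measurable_toLp 2 _).comp ((measurable_mulVec_toLp hA hc).add hW)

/-- The columns in `T` do not contribute to the distance to their span. -/
lemma residual_eq (c : Fin n → ℝ) (T : Finset (Fin n)) (A : Fin m → Fin n → ℝ) (W : Fin m → ℝ) :
    residual c T A W = Metric.infDist (WithLp.toLp 2 W +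
      WithLp.toLp 2 ((Matrix.of A).mulVec fun i => if i ∈ T then 0 else c i))
      (colSpan (Matrix.of A) T : Set (EuclideanSpace ℝ (Fin m))) ^ 2 := by
  have h : observe c A W = (WithLp.toLp 2 W +
      WithLp.toLp 2 ((Matrix.of A).mulVec fun i => if i ∈ T then 0 else c i)) +
      WithLp.toLp 2 ((Matrix.of A).mulVec fun i => if i ∈ T then c i else 0) := by
    have hc : c = (fun i => if i ∈ T then 0 else c i) + fun i => if i ∈ T then c i else 0 := by
      ext i; by_cases hi : i ∈ T <;> simp [hi]
    rw [observe]
    conv_lhs => rw [hc, Matrix.mulVec_add]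
    ext l
    simp only [PiLp.add_apply, Pi.add_apply]
    ring
  rw [residual, h, infDist_add_of_mem (mem_colSpan.2 ⟨c, rfl⟩)]

lemma residual_of_support {c : Fin n → ℝ} {S : Finset (Fin n)} (hc : ∀ i ∉ S, c i = 0)
    (A : Fin m → Fin n → ℝ) (W : Fin m → ℝ) :
    residual c S A W = Metric.infDist (WithLp.toLp 2 W)
      (colSpan (Matrix.of A) S : Set (EuclideanSpace ℝ (Fin m))) ^ 2 := by
  rw [residual_eq]
  have : (fun i => if i ∈ S then 0 else c i) = 0 := by
    ext i; by_cases hi : i ∈ S <;> simp [hi, hc]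
  rw [this, Matrix.mulVec_zero]
  simp

lemma lintegral_gaussianVec_toLp {F : EuclideanSpace ℝ (Fin m) → ENNReal} (hF : Measurable F) :
    ∫⁻ W, F (WithLp.toLp 2 W) ∂gaussianVec m =
      ∫⁻ w, F w ∂stdGaussian (EuclideanSpace ℝ (Fin m)) := by
  rw [← map_pi_eq_stdGaussian, lintegral_map hF (by fun_prop)]

lemma sum_sq_ite (c : Fin n → ℝ) (T : Finset (Fin n)) :
    ∑ i, (if i ∈ T then 0 else c i) ^ 2 = ∑ i ∈ Tᶜ, c i ^ 2 := by
  rw [← Finset.sum_subset (Finset.subset_univ Tᶜ)]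
  · refine Finset.sum_congr rfl fun i hi => ?_
    rw [if_neg (Finset.mem_compl.1 hi)]
  · intro i _ hi
    rw [Finset.mem_compl, not_not] at hi
    simp [hi]

lemma measurable_exp_infDist (a b : ℝ) (U₀ U : Submodule ℝ (EuclideanSpace ℝ (Fin m)))
    (v : EuclideanSpace ℝ (Fin m)) :
    Measurable fun w : EuclideanSpace ℝ (Fin m) => ENNReal.ofReal (Real.exp
      (a * Metric.infDist w (U₀ : Set _) ^ 2 - b * Metric.infDist (w + v) (U : Set _) ^ 2)) := by
  have := Metric.continuous_infDist_pt (U₀ : Set (EuclideanSpace ℝ (Fin m)))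
  have := Metric.continuous_infDist_pt (U : Set (EuclideanSpace ℝ (Fin m)))
  exact ENNReal.measurable_ofReal.comp (Continuous.measurable (by fun_prop))

lemma lintegral_exp_residual_sub_le {c : Fin n → ℝ} {S : Finset (Fin n)} (T : Finset (Fin n))
    (hc : ∀ i ∉ S, c i = 0) :
    ∫⁻ A, ∫⁻ W, ENNReal.ofReal (Real.exp (1 / 4 * (residual c S A W - residual c T A W)))
        ∂gaussianVec m ∂gaussianMat m n ≤
      ENNReal.ofReal (2 ^ (((T \ S).card : ℝ) / 2) *
        (1 + 1 / 4 * ∑ i ∈ Tᶜ, c i ^ 2) ^ (-((m : ℝ) - T.card) / 2)) := by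
  set c' : Fin n → ℝ := fun i => if i ∈ T then 0 else c i with hc'
  have hinner : ∀ A : Fin m → Fin n → ℝ,
      ∫⁻ W, ENNReal.ofReal (Real.exp (1 / 4 * (residual c S A W - residual c T A W)))
        ∂gaussianVec m ≤ ENNReal.ofReal (2 ^ (((T \ S).card : ℝ) / 2)) * ENNReal.ofReal
          (Real.exp (-(1 / 8) * Metric.infDist (WithLp.toLp 2 ((Matrix.of A).mulVec c'))
            (colSpan (Matrix.of A) T : Set (EuclideanSpace ℝ (Fin m))) ^ 2)) := by
    intro A
    set U := colSpan (Matrix.of A) T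
    set U₀ := colSpan (Matrix.of A) (S ∩ T)
    have hU : U₀ ≤ U := colSpan_mono _ Finset.inter_subset_right
    set v : EuclideanSpace ℝ (Fin m) := WithLp.toLp 2 ((Matrix.of A).mulVec c')
    -- drop the columns in `S \ T`, which only increases the distance of the noise
    have h1 : ∀ W : Fin m → ℝ, 1 / 4 * (residual c S A W - residual c T A W) ≤
        1 / 4 * Metric.infDist (WithLp.toLp 2 W) (U₀ : Set (EuclideanSpace ℝ (Fin m))) ^ 2 -
        1 / 4 * Metric.infDist (WithLp.toLp 2 W + v)
          (U : Set (EuclideanSpace ℝ (Fin m))) ^ 2 := by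
      intro W
      rw [residual_of_support hc, residual_eq c T, mul_sub]
      refine sub_le_sub_right (mul_le_mul_of_nonneg_left ?_ (by norm_num)) _
      refine pow_le_pow_left₀ Metric.infDist_nonneg ?_ 2
      exact Metric.infDist_le_infDist_of_subset
        (colSpan_mono _ Finset.inter_subset_left) ⟨0, Submodule.zero_mem _⟩
    refine (lintegral_mono fun W => ENNReal.ofReal_le_ofReal (Real.exp_le_exp.2 (h1 W))).trans ?_
    rw [lintegral_gaussianVec_toLp (F := fun w => ENNReal.ofReal (Real.exp
      (1 / 4 * Metric.infDist w (U₀ : Set (EuclideanSpace ℝ (Fin m))) ^ 2 -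
        1 / 4 * Metric.infDist (w + v) (U : Set (EuclideanSpace ℝ (Fin m))) ^ 2)))
      (measurable_exp_infDist _ _ _ _ _), lintegral_exp_infDist hU (by norm_num) (by norm_num),
      ← ENNReal.ofReal_mul (by positivity)]
    refine ENNReal.ofReal_le_ofReal ?_
    norm_num
    refine mul_le_mul_of_nonneg_right ?_ (Real.exp_pos _).le
    rw [one_div, Real.inv_rpow (by norm_num), ← Real.rpow_neg (by norm_num)]
    refine Real.rpow_le_rpow_of_exponent_le (by norm_num) ?_
    have : (Module.finrank ℝ U : ℝ) ≤ Module.finrank ℝ U₀ + (T \ S).card := by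
      exact_mod_cast finrank_colSpan_le_add _ _ _
    linarith
  refine (lintegral_mono hinner).trans ?_
  rw [lintegral_const_mul' _ _ ENNReal.ofReal_ne_top, ENNReal.ofReal_mul (by positivity)]
  refine mul_le_mul_right ((lintegral_exp_infDist_mulVec_le T (c := c')
    (fun i hi => by simp [hc', hi]) (s := 1 / 8) (by norm_num)).trans_eq ?_) _
  rw [sum_sq_ite]
  norm_num

lemma lintegral_exp_neg_residual_le (c : Fin n → ℝ) (T : Finset (Fin n)) {s : ℝ} (hs : 0 ≤ s) :
    ∫⁻ A, ∫⁻ W, ENNReal.ofReal (Real.exp (-s * residual c T A W))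
        ∂gaussianVec m ∂gaussianMat m n ≤
      ENNReal.ofReal ((1 + 2 * s * (1 + ∑ i ∈ Tᶜ, c i ^ 2)) ^ (-((m : ℝ) - T.card) / 2)) := by
  set c' : Fin n → ℝ := fun i => if i ∈ T then 0 else c i with hc'
  have hs1 : (1 : ℝ) ≤ 1 + 2 * s := by linarith
  have hs0 : (0 : ℝ) < 1 + 2 * s := by linarith
  have hinner : ∀ A : Fin m → Fin n → ℝ,
      ∫⁻ W, ENNReal.ofReal (Real.exp (-s * residual c T A W)) ∂gaussianVec m ≤
        ENNReal.ofReal ((1 + 2 * s) ^ (-((m : ℝ) - T.card) / 2)) * ENNReal.ofReal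
          (Real.exp (-(s / (1 + 2 * s)) * Metric.infDist (WithLp.toLp 2 ((Matrix.of A).mulVec c'))
            (colSpan (Matrix.of A) T : Set (EuclideanSpace ℝ (Fin m))) ^ 2)) := by
    intro A
    set U := colSpan (Matrix.of A) T
    set v : EuclideanSpace ℝ (Fin m) := WithLp.toLp 2 ((Matrix.of A).mulVec c')
    have h1 : ∀ W : Fin m → ℝ, -s * residual c T A W =
        0 * Metric.infDist (WithLp.toLp 2 W) (U : Set (EuclideanSpace ℝ (Fin m))) ^ 2 -
        s * Metric.infDist (WithLp.toLp 2 W + v) (U : Set (EuclideanSpace ℝ (Fin m))) ^ 2 := by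
      intro W
      rw [residual_eq c T]; ring
    simp_rw [h1]
    rw [lintegral_gaussianVec_toLp (F := fun w => ENNReal.ofReal (Real.exp
      (0 * Metric.infDist w (U : Set (EuclideanSpace ℝ (Fin m))) ^ 2 -
        s * Metric.infDist (w + v) (U : Set (EuclideanSpace ℝ (Fin m))) ^ 2)))
      (measurable_exp_infDist _ _ _ _ _), lintegral_exp_infDist le_rfl (by norm_num) (by linarith),
      ← ENNReal.ofReal_mul (by positivity)]
    refine ENNReal.ofReal_le_ofReal ?_
    have h2 : s - 2 * s ^ 2 / (1 + 2 * (s - 0)) = s / (1 + 2 * s) := by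
      rw [sub_zero]; field_simp; ring
    rw [h2, mul_zero, sub_zero, Real.one_rpow, one_mul, sub_zero, finrank_euclideanSpace,
      Fintype.card_fin]
    refine mul_le_mul_of_nonneg_right ?_ (Real.exp_pos _).le
    refine Real.rpow_le_rpow_of_exponent_le hs1 ?_
    have : (Module.finrank ℝ U : ℝ) ≤ T.card := by exact_mod_cast finrank_colSpan_le _ _
    linarith
  refine (lintegral_mono hinner).trans ?_
  rw [lintegral_const_mul' _ _ ENNReal.ofReal_ne_top]
  have hσ : 0 ≤ ∑ i ∈ Tᶜ, c i ^ 2 := Finset.sum_nonneg fun i _ => sq_nonneg _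
  have hfac : 1 + 2 * s * (1 + ∑ i ∈ Tᶜ, c i ^ 2) =
      (1 + 2 * s) * (1 + 2 * (s / (1 + 2 * s)) * ∑ i ∈ Tᶜ, c i ^ 2) := by
    field_simp; ring
  rw [hfac, Real.mul_rpow hs0.le (by positivity), ENNReal.ofReal_mul (by positivity)]
  refine mul_le_mul_right ((lintegral_exp_infDist_mulVec_le T (c := c')
    (fun i hi => by simp [hc', hi]) (s := s / (1 + 2 * s)) (by positivity)).trans_eq ?_) _
  rw [sum_sq_ite]

lemma lintegral_exp_residual {c : Fin n → ℝ} {S : Finset (Fin n)} (hc : ∀ i ∉ S, c i = 0)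
    (hS : S.card ≤ m) {t : ℝ} (ht : t < 1 / 2) :
    ∫⁻ A, ∫⁻ W, ENNReal.ofReal (Real.exp (t * residual c S A W)) ∂gaussianVec m ∂gaussianMat m n =
      ENNReal.ofReal ((1 - 2 * t) ^ (-((m : ℝ) - S.card) / 2)) := by
  have hinner : ∀ᵐ A ∂gaussianMat m n,
      ∫⁻ W, ENNReal.ofReal (Real.exp (t * residual c S A W)) ∂gaussianVec m =
        ENNReal.ofReal ((1 - 2 * t) ^ (-((m : ℝ) - S.card) / 2)) := by
    filter_upwards [ae_finrank_colSpan S hS] with A hA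
    simp_rw [residual_of_support hc]
    have := measurable_exp_infDist t 0 (colSpan (Matrix.of A) S) (colSpan (Matrix.of A) S) 0
    have h2 := lintegral_exp_infDist (le_refl (colSpan (Matrix.of A) S)) (t := t) (τ := 0)
      (by linarith) (by linarith) 0
    simp only [zero_mul, sub_zero] at this h2
    rw [lintegral_gaussianVec_toLp (F := fun w => ENNReal.ofReal (Real.exp (t * Metric.infDist w
      (colSpan (Matrix.of A) S : Set (EuclideanSpace ℝ (Fin m))) ^ 2))) this, h2, hA]
    norm_num [← sub_eq_add_neg]
  rw [lintegral_congr_ae hinner]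
  simp

end Cost

section Union

variable {m n J : ℕ}

/-- The law of the measurement matrices and of the noise vectors. -/
abbrev channelLaw (m n J : ℕ) : Measure ((Fin J → Fin m → Fin n → ℝ) × (Fin J → Fin m → ℝ)) :=
  (Measure.pi fun _ => gaussianMat m n).prod (Measure.pi fun _ => gaussianVec m)

/-- The nearest-subspace cost of `T` when the vector `c j` is measured by `A_j` with noise `W_j`. -/
def totalResidual (c : Fin J → Fin n → ℝ) (T : Finset (Fin n))
    (ω : (Fin J → Fin m → Fin n → ℝ) × (Fin J → Fin m → ℝ)) : ℝ :=
  ∑ j, residual (c j) T (ω.1 j) (ω.2 j)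

lemma measurable_totalResidual {Ω : Type*} [MeasurableSpace Ω] (T : Finset (Fin n))
    {c : Ω → Fin J → Fin n → ℝ} {p : Ω → (Fin J → Fin m → Fin n → ℝ) × (Fin J → Fin m → ℝ)}
    (hc : Measurable c) (hp : Measurable p) :
    Measurable fun ω => totalResidual (c ω) T (p ω) := by
  unfold SparsityRecovery.totalResidual
  exact Finset.measurable_sum _ fun j _ =>
    measurable_residual T (by fun_prop) (by fun_prop) (by fun_prop)

lemma lintegral_channelLaw_prod
    (f : Fin J → (Fin m → Fin n → ℝ) → (Fin m → ℝ) → ENNReal)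
    (hf : ∀ j, Measurable fun p : (Fin m → Fin n → ℝ) × (Fin m → ℝ) => f j p.1 p.2) :
    ∫⁻ ω, ∏ j, f j (ω.1 j) (ω.2 j) ∂channelLaw m n J =
      ∏ j, ∫⁻ A, ∫⁻ W, f j A W ∂gaussianVec m ∂gaussianMat m n := by
  rw [lintegral_prod]
  · have h : ∀ A : Fin J → Fin m → Fin n → ℝ,
        ∫⁻ W, ∏ j, f j (A j) (W j) ∂(Measure.pi fun _ => gaussianVec m) =
          ∏ j, ∫⁻ W, f j (A j) W ∂gaussianVec m := fun A =>
      lintegral_pi_prod _ (fun j W => f j (A j) W) fun j => (hf j).comp measurable_prodMk_left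
    simp_rw [h]
    exact lintegral_pi_prod _ (fun j A => ∫⁻ W, f j A W ∂gaussianVec m)
      fun j => (hf j).lintegral_prod_right'
  · refine (Finset.measurable_prod _ fun j _ => ?_).aemeasurable
    exact (hf j).comp (g := fun p : (Fin m → Fin n → ℝ) × (Fin m → ℝ) => f j p.1 p.2)
      (f := fun ω : (Fin J → Fin m → Fin n → ℝ) × (Fin J → Fin m → ℝ) => (ω.1 j, ω.2 j))
      (by fun_prop)

lemma measure_nonneg_le_lintegral_exp {Ω : Type*} [MeasurableSpace Ω] (μ : Measure Ω) {g : Ω → ℝ}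
    (hg : Measurable g) : μ {ω | 0 ≤ g ω} ≤ ∫⁻ ω, ENNReal.ofReal (Real.exp (g ω)) ∂μ := by
  have h1 := mul_meas_ge_le_lintegral (μ := μ)
    (f := fun ω => ENNReal.ofReal (Real.exp (g ω))) (by fun_prop) 1
  rw [one_mul] at h1
  refine (measure_mono fun ω hω => ?_).trans h1
  simpa using hω

lemma ofReal_exp_sum {ι : Type*} (s : Finset ι) (g : ι → ℝ) :
    ENNReal.ofReal (Real.exp (∑ j ∈ s, g j)) = ∏ j ∈ s, ENNReal.ofReal (Real.exp (g j)) := by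
  rw [Real.exp_sum, ENNReal.ofReal_prod_of_nonneg fun i _ => (Real.exp_pos _).le]

lemma one_add_sum_le_prod_one_add {ι : Type*} (s : Finset ι) {a : ι → ℝ} (ha : ∀ i, 0 ≤ a i) :
    1 + ∑ i ∈ s, a i ≤ ∏ i ∈ s, (1 + a i) :=
  by
  classical
  induction s using Finset.induction_on with
  | empty => simp
  | insert j s hj ih =>
    rw [Finset.sum_insert hj, Finset.prod_insert hj]
    have h1 : 0 ≤ ∑ i ∈ s, a i := Finset.sum_nonneg fun i _ => ha i
    nlinarith [mul_le_mul_of_nonneg_left ih (ha j), mul_nonneg (ha j) h1]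

/-- The probability that `T` has a cost at most that of the sparsity pattern `S`, bounded through
the total power `q` that the vectors have off `T`. -/
lemma channelLaw_totalResidual_le {c : Fin J → Fin n → ℝ} {S : Finset (Fin n)}
    (T : Finset (Fin n)) (hc : ∀ j, ∀ i ∉ S, c j i = 0) (hT : T.card ≤ m) {q : ℝ} (hq : 0 ≤ q)
    (hcq : q ≤ ∑ j, ∑ i ∈ Tᶜ, c j i ^ 2) :
    channelLaw m n J {ω | totalResidual c T ω ≤ totalResidual c S ω} ≤
      ENNReal.ofReal (2 ^ (J * ((T \ S).card : ℝ) / 2) *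
        (1 + 1 / 4 * q) ^ (-((m : ℝ) - T.card) / 2)) := by
  have hσ : ∀ j, 0 ≤ ∑ i ∈ Tᶜ, c j i ^ 2 := fun j => Finset.sum_nonneg fun i _ => sq_nonneg _
  have hset : {ω : (Fin J → Fin m → Fin n → ℝ) × (Fin J → Fin m → ℝ) |
      totalResidual c T ω ≤ totalResidual c S ω} =
      {ω | 0 ≤ ∑ j, 1 / 4 *
        (residual (c j) S (ω.1 j) (ω.2 j) - residual (c j) T (ω.1 j) (ω.2 j))} := by
    ext ω
    simp only [totalResidual, Set.mem_ofPred_eq]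
    rw [← Finset.mul_sum, Finset.sum_sub_distrib]
    constructor <;> intro h <;> linarith
  rw [hset]
  have hm : ∀ j T', Measurable fun p : (Fin m → Fin n → ℝ) × (Fin m → ℝ) =>
      residual (c j) T' p.1 p.2 := fun j T' =>
    measurable_residual T' measurable_const measurable_fst measurable_snd
  have hm' : ∀ j T', Measurable fun ω : (Fin J → Fin m → Fin n → ℝ) × (Fin J → Fin m → ℝ) =>
      residual (c j) T' (ω.1 j) (ω.2 j) := fun j T' =>
    measurable_residual T' measurable_const (by fun_prop) (by fun_prop)
  refine (measure_nonneg_le_lintegral_exp _ (Finset.measurable_sum _ fun j _ =>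
    ((hm' j S).sub (hm' j T)).const_mul _)).trans ?_
  simp_rw [Pi.sub_apply, ofReal_exp_sum]
  rw [lintegral_channelLaw_prod (fun j A W => ENNReal.ofReal (Real.exp
    (1 / 4 * (residual (c j) S A W - residual (c j) T A W))))
    fun j => ENNReal.measurable_ofReal.comp (Real.measurable_exp.comp
      (((hm j S).sub (hm j T)).const_mul _))]
  refine (Finset.prod_le_prod' fun j _ => lintegral_exp_residual_sub_le T (hc j)).trans ?_
  rw [← ENNReal.ofReal_prod_of_nonneg fun j _ => mul_nonneg (by positivity)
    (Real.rpow_nonneg (by have := hσ j; linarith) _)]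
  refine ENNReal.ofReal_le_ofReal ?_
  rw [Finset.prod_mul_distrib, Finset.prod_const, Finset.card_univ, Fintype.card_fin,
    ← Real.rpow_natCast, ← Real.rpow_mul (by norm_num)]
  have he : ((T \ S).card : ℝ) / 2 * J = J * ((T \ S).card : ℝ) / 2 := by ring
  rw [he, Real.finsetProd_rpow _ _ fun j _ => (by have := hσ j; linarith)]
  refine mul_le_mul_of_nonneg_left ?_ (by positivity)
  have hT' : (T.card : ℝ) ≤ m := by exact_mod_cast hT
  refine Real.rpow_le_rpow_of_nonpos (by linarith) ?_ (by linarith)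
  refine le_trans ?_ (one_add_sum_le_prod_one_add _ fun j => mul_nonneg (by norm_num) (hσ j))
  rw [← Finset.mul_sum]
  linarith

/-- The probability that the cost of `T` is at most `B`, bounded through the power `q` that each
vector has off `T`. -/
lemma channelLaw_totalResidual_le_const (c : Fin J → Fin n → ℝ)
    (T : Finset (Fin n)) (hT : T.card ≤ m) {q s : ℝ} (hs : 0 ≤ s) (hq : 0 ≤ q)
    (hcq : ∀ j, q ≤ ∑ i ∈ Tᶜ, c j i ^ 2) (B : ℝ) :
    channelLaw m n J {ω | totalResidual c T ω ≤ B} ≤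
      ENNReal.ofReal (Real.exp (s * B) *
        (1 + 2 * s * (1 + q)) ^ (-(J * ((m : ℝ) - T.card)) / 2)) := by
  have hm : ∀ j, Measurable fun p : (Fin m → Fin n → ℝ) × (Fin m → ℝ) =>
      residual (c j) T p.1 p.2 := fun j =>
    measurable_residual T measurable_const measurable_fst measurable_snd
  have hm' : Measurable fun ω : (Fin J → Fin m → Fin n → ℝ) × (Fin J → Fin m → ℝ) =>
      totalResidual c T ω := measurable_totalResidual T measurable_const measurable_id
  have hsub : {ω : (Fin J → Fin m → Fin n → ℝ) × (Fin J → Fin m → ℝ) | totalResidual c T ω ≤ B} ⊆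
      {ω | 0 ≤ s * B + -s * totalResidual c T ω} := by
    intro ω hω
    have := mul_le_mul_of_nonneg_left (show totalResidual c T ω ≤ B from hω) hs
    simp only [Set.mem_ofPred_eq]
    linarith
  refine (measure_mono hsub).trans ((measure_nonneg_le_lintegral_exp _
    ((hm'.const_mul _).const_add _)).trans ?_)
  simp_rw [Real.exp_add, ENNReal.ofReal_mul (Real.exp_pos _).le, totalResidual, Finset.mul_sum,
    ofReal_exp_sum]
  rw [lintegral_const_mul' _ _ ENNReal.ofReal_ne_top]
  refine mul_le_mul_right ?_ _
  rw [lintegral_channelLaw_prod (fun j A W => ENNReal.ofReal (Real.exp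
    (-s * residual (c j) T A W)))
    fun j => ENNReal.measurable_ofReal.comp (Real.measurable_exp.comp ((hm j).const_mul _))]
  have hT' : (T.card : ℝ) ≤ m := by exact_mod_cast hT
  refine (Finset.prod_le_prod' (g := fun _ => ENNReal.ofReal ((1 + 2 * s * (1 + q)) ^
    (-((m : ℝ) - T.card) / 2))) fun j _ => (lintegral_exp_neg_residual_le (c j) T hs).trans
      (ENNReal.ofReal_le_ofReal ?_)).trans ?_
  · refine Real.rpow_le_rpow_of_nonpos (by positivity) ?_ (by linarith)
    have := hcq j
    gcongr
  · rw [Finset.prod_const, Finset.card_univ, Fintype.card_fin, ← ENNReal.ofReal_pow (by positivity),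
      ← Real.rpow_natCast, ← Real.rpow_mul (by positivity)]
    refine (congrArg _ (congrArg _ ?_)).le
    ring

/-- The cost of the sparsity pattern itself is unlikely to be large. -/
lemma channelLaw_le_totalResidual {c : Fin J → Fin n → ℝ} {S : Finset (Fin n)}
    (hc : ∀ j, ∀ i ∉ S, c j i = 0) (hS : S.card ≤ m) {t : ℝ} (ht0 : 0 ≤ t) (ht : t < 1 / 2)
    (B : ℝ) :
    channelLaw m n J {ω | B ≤ totalResidual c S ω} ≤
      ENNReal.ofReal (Real.exp (-(t * B)) *
        (1 - 2 * t) ^ (-(J * ((m : ℝ) - S.card)) / 2)) := by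
  have hm : ∀ j, Measurable fun p : (Fin m → Fin n → ℝ) × (Fin m → ℝ) =>
      residual (c j) S p.1 p.2 := fun j =>
    measurable_residual S measurable_const measurable_fst measurable_snd
  have hm' : Measurable fun ω : (Fin J → Fin m → Fin n → ℝ) × (Fin J → Fin m → ℝ) =>
      totalResidual c S ω := measurable_totalResidual S measurable_const measurable_id
  have hsub : {ω : (Fin J → Fin m → Fin n → ℝ) × (Fin J → Fin m → ℝ) | B ≤ totalResidual c S ω} ⊆
      {ω | 0 ≤ -(t * B) + t * totalResidual c S ω} := by
    intro ω hω
    have := mul_le_mul_of_nonneg_left (show B ≤ totalResidual c S ω from hω) ht0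
    simp only [Set.mem_ofPred_eq]
    linarith
  refine (measure_mono hsub).trans ((measure_nonneg_le_lintegral_exp _
    ((hm'.const_mul _).const_add _)).trans ?_)
  simp_rw [Real.exp_add, ENNReal.ofReal_mul (Real.exp_pos _).le, totalResidual, Finset.mul_sum,
    ofReal_exp_sum]
  rw [lintegral_const_mul' _ _ ENNReal.ofReal_ne_top]
  refine mul_le_mul_right ?_ _
  rw [lintegral_channelLaw_prod (fun j A W => ENNReal.ofReal (Real.exp
    (t * residual (c j) S A W)))
    fun j => ENNReal.measurable_ofReal.comp (Real.measurable_exp.comp ((hm j).const_mul _))]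
  simp_rw [fun j => lintegral_exp_residual (hc j) hS ht]
  have h1 : 0 < 1 - 2 * t := by linarith
  rw [Finset.prod_const, Finset.card_univ, Fintype.card_fin, ← ENNReal.ofReal_pow (by positivity),
      ← Real.rpow_natCast, ← Real.rpow_mul (by positivity)]
  refine (congrArg _ (congrArg _ ?_)).le
  ring

end Union

/-! ### Quantile functions and the diversity power -/

section Quantile

variable {μ : Measure ℝ} [IsProbabilityMeasure μ] {p : ℝ}

lemma sInf_le_iff_le_cdf (hp0 : 0 < p) (hp1 : p < 1) (x : ℝ) :
    sInf {t : ℝ | p ≤ μ.real (Set.Iic t)} ≤ x ↔ p ≤ μ.real (Set.Iic x) := by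
  simp_rw [← cdf_eq_real]
  set A : Set ℝ := {t : ℝ | p ≤ cdf μ t} with hA
  have hne : A.Nonempty := by
    obtain ⟨t, ht⟩ := ((tendsto_cdf_atTop μ).eventually (eventually_gt_nhds hp1)).exists
    exact ⟨t, ht.le⟩
  have hbdd : BddBelow A := by
    obtain ⟨y, hy⟩ := ((tendsto_cdf_atBot μ).eventually (eventually_lt_nhds hp0)).exists
    refine ⟨y, fun t ht => ?_⟩
    by_contra h
    exact absurd ((show p ≤ cdf μ t from ht).trans (monotone_cdf μ (not_le.1 h).le)) (not_le.2 hy)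
  have hmem : p ≤ cdf μ (sInf A) := by
    have hlim : Tendsto (cdf μ) (𝓝[>] sInf A) (𝓝 (cdf μ (sInf A))) :=
      ((cdf μ).right_continuous (sInf A)).mono_left (nhdsWithin_mono _ Set.Ioi_subset_Ici_self)
    refine ge_of_tendsto hlim ?_
    filter_upwards [self_mem_nhdsWithin] with y hy
    obtain ⟨t, ht, hty⟩ := exists_lt_of_csInf_lt hne hy
    exact (show p ≤ cdf μ t from ht).trans (monotone_cdf μ hty.le)
  exact ⟨fun h => hmem.trans (monotone_cdf μ h), fun h => csInf_le hbdd h⟩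

lemma monotoneOn_quantile (μ : Measure ℝ) [IsProbabilityMeasure μ] :
    MonotoneOn (fun p => sInf {t : ℝ | p ≤ μ.real (Set.Iic t)}) (Set.Ioo 0 1) := by
  intro p hp q hq hpq
  exact (sInf_le_iff_le_cdf hp.1 hp.2 _).2
    (hpq.trans ((sInf_le_iff_le_cdf (μ := μ) hq.1 hq.2 _).1 le_rfl))

/-- A real random variable is the quantile function of its law at a uniform variable. -/
lemma map_quantile (μ : Measure ℝ) [IsProbabilityMeasure μ] :
    (volume.restrict (Set.Ioo (0 : ℝ) 1)).map
      (fun p => sInf {t : ℝ | p ≤ μ.real (Set.Iic t)}) = μ := by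
  have hae : AEMeasurable (fun p => sInf {t : ℝ | p ≤ μ.real (Set.Iic t)})
      (volume.restrict (Set.Ioo (0 : ℝ) 1)) :=
    aemeasurable_restrict_of_monotoneOn measurableSet_Ioo (monotoneOn_quantile μ)
  have : IsProbabilityMeasure (volume.restrict (Set.Ioo (0 : ℝ) 1)) := ⟨by simp⟩
  have := Measure.isProbabilityMeasure_map hae
  refine Measure.eq_of_cdf _ _ ?_
  ext x
  rw [cdf_eq_real, cdf_eq_real]
  have h0 : 0 ≤ μ.real (Set.Iic x) := measureReal_nonneg
  have h1 : μ.real (Set.Iic x) ≤ 1 := measureReal_le_one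
  rw [measureReal_def, Measure.map_apply_of_aemeasurable hae measurableSet_Iic,
    Measure.restrict_apply₀' measurableSet_Ioo.nullMeasurableSet]
  set c := μ.real (Set.Iic x)
  have hset : ((fun p => sInf {t : ℝ | p ≤ μ.real (Set.Iic t)}) ⁻¹' Set.Iic x) ∩ Set.Ioo 0 1 =
      Set.Iic c ∩ Set.Ioo 0 1 := by
    ext p
    simp only [Set.mem_inter_iff, Set.mem_preimage, Set.mem_Iic]
    constructor
    · rintro ⟨h, hp⟩; exact ⟨(sInf_le_iff_le_cdf hp.1 hp.2 x).1 h, hp⟩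
    · rintro ⟨h, hp⟩; exact ⟨(sInf_le_iff_le_cdf hp.1 hp.2 x).2 h, hp⟩
  rw [hset]
  have hv : volume (Set.Iic c ∩ Set.Ioo (0 : ℝ) 1) = ENNReal.ofReal c := by
    refine le_antisymm ?_ ?_
    · refine (measure_mono (t := Set.Ioc 0 c) ?_).trans (by simp)
      rintro p ⟨h, hp⟩; exact ⟨hp.1, h⟩
    · refine le_trans (by simp) (measure_mono (s := Set.Ioo 0 c) ?_)
      rintro p hp; exact ⟨hp.2.le, hp.1, hp.2.trans_le h1⟩
  rw [hv, ENNReal.toReal_ofReal h0]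

end Quantile

section DiversityPower

variable {J : ℕ}

instance (J : ℕ) : IsProbabilityMeasure (normChiSq J) :=
  Measure.isProbabilityMeasure_map (Measurable.aemeasurable (by fun_prop))

lemma normChiSq_Iic_zero (hJ : 1 ≤ J) : normChiSq J (Set.Iic 0) = 0 := by
  rw [normChiSq, Measure.map_apply (by fun_prop) measurableSet_Iic]
  let j : Fin J := ⟨0, hJ⟩
  have hsub : ((fun z : Fin J → ℝ => 1 / (J : ℝ) * ∑ j, z j ^ 2) ⁻¹' Set.Iic 0) ⊆
      (fun z : Fin J → ℝ => z j) ⁻¹' {0} := by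
    intro z hz
    have hJ' : (0 : ℝ) < 1 / J := by positivity
    have h1 : ∑ j, z j ^ 2 ≤ 0 := by
      by_contra h
      exact absurd hz (not_le.2 (mul_pos hJ' (not_le.1 h)))
    have h2 : z j ^ 2 ≤ ∑ j, z j ^ 2 :=
      Finset.single_le_sum (f := fun j => z j ^ 2) (fun i _ => sq_nonneg _) (Finset.mem_univ j)
    exact pow_eq_zero_iff two_ne_zero |>.1 (le_antisymm (h2.trans h1) (sq_nonneg _))
  refine measure_mono_null hsub ?_
  have := nullSingletonClass_gaussianReal (μ := 0) (v := 1) one_ne_zero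
  rw [(measurePreserving_eval (fun _ : Fin J => gaussianReal 0 1) j).measure_preimage
    (measurableSet_singleton 0).nullMeasurableSet]
  simp

lemma normChiSq_real_Iic_of_nonpos (hJ : 1 ≤ J) {x : ℝ} (hx : x ≤ 0) :
    (normChiSq J).real (Set.Iic x) = 0 := by
  rw [measureReal_def, measure_mono_null (Set.Iic_subset_Iic.2 hx) (normChiSq_Iic_zero hJ)]
  rfl

lemma chiSqQuantile_pos (hJ : 1 ≤ J) {p : ℝ} (hp0 : 0 < p) (hp1 : p < 1) :
    0 < chiSqQuantile J p := by
  by_contra h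
  have := (sInf_le_iff_le_cdf (μ := normChiSq J) hp0 hp1 0).1 (not_lt.1 h)
  rw [normChiSq_real_Iic_of_nonpos hJ le_rfl] at this
  linarith

/-- At `p = 0` the infimum is over all reals, hence the junk value `0`. -/
lemma chiSqQuantile_zero : chiSqQuantile J 0 = 0 := by
  have : {t : ℝ | 0 ≤ (normChiSq J).real (Set.Iic t)} = Set.univ :=
    Set.eq_univ_of_forall fun t => measureReal_nonneg
  rw [chiSqQuantile, this, Real.sInf_univ]

lemma monotoneOn_chiSqQuantile (hJ : 1 ≤ J) : MonotoneOn (chiSqQuantile J) (Set.Ico 0 1) := by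
  intro p hp q hq hpq
  rcases hp.1.eq_or_lt with rfl | hp0
  · rw [chiSqQuantile_zero]
    rcases hpq.eq_or_lt with rfl | hq0
    · rw [chiSqQuantile_zero]
    · exact (chiSqQuantile_pos hJ hq0 hq.2).le
  · exact monotoneOn_quantile (normChiSq J) ⟨hp0, hp.2⟩ ⟨hp0.trans_le hpq, hq.2⟩ hpq

lemma integrable_id_normChiSq (J : ℕ) : Integrable (fun x : ℝ => x) (normChiSq J) := by
  rw [normChiSq, integrable_map_measure (by fun_prop) (Measurable.aemeasurable (by fun_prop))]
  refine Integrable.const_mul (integrable_finsetSum _ fun j _ => ?_) _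
  have : Integrable (fun x : ℝ => x ^ 2) (gaussianReal 0 1) :=
    IsGaussian.memLp_two_id.integrable_sq
  exact (measurePreserving_eval (fun _ : Fin J => gaussianReal 0 1) j).integrable_comp_of_integrable
    this

lemma integrableOn_chiSqQuantile (J : ℕ) : IntegrableOn (chiSqQuantile J) (Set.Ioo 0 1) := by
  have h := integrable_id_normChiSq J
  rw [← map_quantile (normChiSq J), integrable_map_measure (by fun_prop)
    (aemeasurable_restrict_of_monotoneOn measurableSet_Ioo (monotoneOn_quantile _))] at h
  exact h

lemma intervalIntegrable_chiSqQuantile {a b : ℝ} (ha0 : 0 ≤ a) (hb1 : b ≤ 1) (hab : a ≤ b) :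
    IntervalIntegrable (chiSqQuantile J) volume a b := by
  rw [intervalIntegrable_iff_integrableOn_Ioo_of_le hab]
  exact (integrableOn_chiSqQuantile J).mono_set (Set.Ioo_subset_Ioo ha0 hb1)

lemma continuousOn_diversityPower (J : ℕ) : ContinuousOn (diversityPower J) (Set.Icc 0 1) := by
  refine intervalIntegral.continuousOn_primitive_interval' (b₁ := 0) (b₂ := 1)
    (intervalIntegrable_chiSqQuantile le_rfl le_rfl zero_le_one) ?_ |>.mono ?_
  · simp
  · rw [Set.uIcc_of_le zero_le_one]

lemma diversityPower_pos (hJ : 1 ≤ J) {β : ℝ} (h0 : 0 < β) (h1 : β ≤ 1) :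
    0 < diversityPower J β :=
  intervalIntegral.intervalIntegral_pos_of_pos_on
    (intervalIntegrable_chiSqQuantile le_rfl h1 h0.le)
    (fun _ hx => chiSqQuantile_pos hJ hx.1 (hx.2.trans_le h1)) h0

lemma diversityPower_le_mul (hJ : 1 ≤ J) {β : ℝ} (h0 : 0 ≤ β) (h1 : β < 1) :
    diversityPower J β ≤ β * chiSqQuantile J β := by
  have := intervalIntegral.integral_mono_on (μ := volume) h0
    (intervalIntegrable_chiSqQuantile (J := J) le_rfl h1.le h0)
    (intervalIntegrable_const (c := chiSqQuantile J β))
    (fun x hx => monotoneOn_chiSqQuantile hJ ⟨hx.1, hx.2.trans_lt h1⟩ ⟨h0, h1⟩ hx.2)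
  simpa [diversityPower] using this

/-- The diversity power is the Legendre transform of the expected shortfall: equality holds at the
threshold `ξ_J(β)`. -/
lemma integral_shortfall (hJ : 1 ≤ J) {β : ℝ} (h0 : 0 < β) (h1 : β < 1) :
    ∫ z, max (chiSqQuantile J β - z) 0 ∂normChiSq J =
      β * chiSqQuantile J β - diversityPower J β := by
  set t := chiSqQuantile J β with ht
  have hstep : ∫ z, max (t - z) 0 ∂normChiSq J =
      ∫ p in Set.Ioo (0 : ℝ) 1, max (t - chiSqQuantile J p) 0 := by
    conv_lhs => rw [← map_quantile (normChiSq J)]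
    rw [integral_map (aemeasurable_restrict_of_monotoneOn measurableSet_Ioo (monotoneOn_quantile _))
      (by fun_prop)]
    rfl
  have hind : ∀ p ∈ Set.Ioo (0 : ℝ) 1, max (t - chiSqQuantile J p) 0 =
      (Set.Ioc 0 β).indicator (fun p => t - chiSqQuantile J p) p := by
    intro p hp
    have hmono := monotoneOn_chiSqQuantile hJ
    have hp' : p ∈ Set.Ico (0 : ℝ) 1 := ⟨hp.1.le, hp.2⟩
    have hβ' : β ∈ Set.Ico (0 : ℝ) 1 := ⟨h0.le, h1⟩
    by_cases hpβ : p ≤ β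
    · rw [Set.indicator_of_mem (show p ∈ Set.Ioc 0 β from ⟨hp.1, hpβ⟩), max_eq_left]
      exact sub_nonneg.2 (hmono hp' hβ' hpβ)
    · rw [Set.indicator_of_notMem fun h => hpβ h.2, max_eq_right]
      exact sub_nonpos.2 (hmono hβ' hp' (not_le.1 hpβ).le)
  have hinter : Set.Ioo (0 : ℝ) 1 ∩ Set.Ioc 0 β = Set.Ioc 0 β :=
    Set.inter_eq_right.2 (by intro p hp; exact ⟨hp.1, hp.2.trans_lt h1⟩)
  rw [hstep, setIntegral_congr_fun measurableSet_Ioo hind,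
    setIntegral_indicator measurableSet_Ioc, hinter, ← intervalIntegral.integral_of_le h0.le,
    intervalIntegral.integral_sub intervalIntegrable_const
      (intervalIntegrable_chiSqQuantile le_rfl h1.le h0.le)]
  simp [diversityPower]

end DiversityPower

/-! ### The least energetic part of the signal -/

section OrderStatistics

/-- The law of the entries of the `J` vectors, before they are restricted to the sparsity
pattern. -/
abbrev signalLaw (n J : ℕ) : Measure (Fin J → Fin n → ℝ) := Measure.pi fun _ => gaussianVec n

lemma measurePreserving_swap_signal (n J : ℕ) :
    MeasurePreserving (fun (X : Fin J → Fin n → ℝ) i j => X j i) (signalLaw n J)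
      (Measure.pi fun _ : Fin n => gaussianVec J) := by
  have hcurry : ∀ a b : ℕ, MeasurePreserving (MeasurableEquiv.curry (Fin a) (Fin b) ℝ)
      (Measure.pi fun _ => gaussianReal 0 1) (Measure.pi fun _ => Measure.pi fun _ =>
        gaussianReal 0 1) := by
    intro a b
    refine ⟨MeasurableEquiv.measurable _, ?_⟩
    have := Measure.infinitePi_map_curry (fun (_ : Fin a) (_ : Fin b) => gaussianReal 0 1)
    simpa only [Measure.infinitePi_eq_pi] using this
  have h2 := measurePreserving_piCongrLeft (α := fun _ : Fin n × Fin J => ℝ)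
    (fun _ => gaussianReal 0 1) (Equiv.prodComm (Fin J) (Fin n))
  have h := (hcurry n J).comp (h2.comp (hcurry J n).symm)
  convert! h using 1

/-- Chebyshev's inequality for a sum of bounded functions of independent variables. -/
lemma measure_pi_sum_ge_le {n : ℕ} {Ω : Type*} [MeasurableSpace Ω] (ν : Measure Ω)
    [IsProbabilityMeasure ν] {g : Ω → ℝ} (hg : Measurable g) {t : ℝ}
    (hgt : ∀ x, g x ∈ Set.Icc 0 t) {ε : ℝ} (hε : 0 < ε) (S : Finset (Fin n)) (hS : 0 < S.card) :
    (Measure.pi fun _ : Fin n => ν)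
        {x : Fin n → Ω | (S.card : ℝ) * (∫ y, g y ∂ν + ε) ≤ ∑ i ∈ S, g (x i)} ≤
      ENNReal.ofReal ((t / 2) ^ 2 / ε ^ 2 / S.card) := by
  have hSr : (0 : ℝ) < S.card := by exact_mod_cast hS
  set P := Measure.pi fun _ : Fin n => ν
  let Z : Fin n → (Fin n → Ω) → ℝ := fun i x => g (x i)
  have hZ : ∀ i, MemLp (Z i) 2 P := fun i =>
    memLp_of_bounded (a := 0) (b := t) (ae_of_all _ fun x : Fin n → Ω => hgt (x i))
      (hg.comp (measurable_pi_apply i)).aestronglyMeasurable 2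
  have hsum : MemLp (∑ i ∈ S, Z i) 2 P := memLp_finsetSum' _ fun i _ => hZ i
  have hind : iIndepFun Z P := iIndepFun_pi (X := fun _ => g) fun i => hg.aemeasurable
  have hmean : ∫ x, (∑ i ∈ S, Z i) x ∂P = S.card * ∫ y, g y ∂ν := by
    simp_rw [Finset.sum_apply]
    rw [integral_finsetSum _ fun i _ => (hZ i).integrable (by norm_num)]
    have : ∀ i, ∫ x, Z i x ∂P = ∫ y, g y ∂ν := fun i =>
      integral_comp_eval (μ := fun _ : Fin n => ν) hg.aestronglyMeasurable
    simp [this]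
  have hvar : Var[∑ i ∈ S, Z i; P] ≤ S.card * (t / 2) ^ 2 := by
    rw [IndepFun.variance_sum (fun i _ => hZ i) fun i _ j _ hij => hind.indepFun hij]
    have : ∀ i ∈ S, Var[Z i; P] ≤ (t / 2) ^ 2 := fun i _ => by
      have := variance_le_sq_of_bounded (μ := P) (X := Z i) (a := 0) (b := t)
        (ae_of_all _ fun x => hgt (x i)) (hg.comp (measurable_pi_apply i)).aemeasurable
      simpa using this
    simpa using Finset.sum_le_card_nsmul S _ _ this
  refine (measure_mono fun x hx => ?_).trans
    ((meas_ge_le_variance_div_sq hsum (mul_pos hSr hε)).trans (ENNReal.ofReal_le_ofReal ?_))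
  · simp only [Set.mem_ofPred_eq] at hx ⊢
    rw [hmean]
    refine le_trans ?_ (le_abs_self _)
    rw [Finset.sum_apply]
    have : ∑ i ∈ S, Z i x = ∑ i ∈ S, g (x i) := rfl
    rw [this]
    linarith
  · calc Var[∑ i ∈ S, Z i; P] / (S.card * ε) ^ 2
        ≤ (S.card * (t / 2) ^ 2) / (S.card * ε) ^ 2 := by gcongr
      _ = _ := by field_simp

/-- Any part of the signal with at least the fraction `β` of the support carries, up to `ε`, the
energy `P_J(β)`, since the energy of a part `U` is at least `t |U|` minus the total shortfall below
the level `t`, for which the law of large numbers holds. -/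
lemma exists_measure_energy_lt_le {J : ℕ} (hJ : 1 ≤ J) {β ε : ℝ} (hβ0 : 0 < β) (hβ1 : β < 1)
    (hε : 0 < ε) :
    ∃ C : ℝ, ∀ (n : ℕ) (S : Finset (Fin n)), 0 < S.card →
      (Measure.pi fun _ : Fin n => gaussianVec J) {x | ∃ U ⊆ S, β * S.card ≤ U.card ∧
        ∑ i ∈ U, 1 / (J : ℝ) * ∑ j, x i j ^ 2 < S.card * (diversityPower J β - ε)} ≤
      ENNReal.ofReal (C / S.card) := by
  set t := chiSqQuantile J β with ht
  have ht0 : 0 < t := chiSqQuantile_pos hJ hβ0 hβ1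
  let z : (Fin J → ℝ) → ℝ := fun x => 1 / (J : ℝ) * ∑ j, x j ^ 2
  have hz0 : ∀ x, 0 ≤ z x := fun x =>
    mul_nonneg (by positivity) (Finset.sum_nonneg fun _ _ => sq_nonneg _)
  have hzm : Measurable z := by fun_prop
  let g : (Fin J → ℝ) → ℝ := fun x => max (t - z x) 0
  have hgm : Measurable g := by fun_prop
  have hgt : ∀ x, g x ∈ Set.Icc 0 t := fun x =>
    ⟨le_max_right _ _, max_le (by linarith [hz0 x]) ht0.le⟩
  have hmean : ∫ y, g y ∂gaussianVec J = β * t - diversityPower J β := by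
    rw [← integral_shortfall hJ hβ0 hβ1, normChiSq, integral_map hzm.aemeasurable (by fun_prop)]
  refine ⟨(t / 2) ^ 2 / ε ^ 2, fun n S hS => ?_⟩
  refine (measure_mono ?_).trans (measure_pi_sum_ge_le (gaussianVec J) hgm hgt hε S hS)
  rintro x ⟨U, hUS, hU, hlt⟩
  simp only [Set.mem_ofPred_eq]
  rw [hmean]
  have h1 : ∑ i ∈ U, (t - g (x i)) ≤ ∑ i ∈ U, z (x i) := Finset.sum_le_sum fun i _ => by
    have := le_max_left (t - z (x i)) 0
    simp only [g]; linarith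
  have h2 : ∑ i ∈ U, g (x i) ≤ ∑ i ∈ S, g (x i) :=
    Finset.sum_le_sum_of_subset_of_nonneg hUS fun i _ _ => (hgt _).1
  rw [Finset.sum_sub_distrib, Finset.sum_const, nsmul_eq_mul] at h1
  have h3 : β * S.card * t ≤ U.card * t := mul_le_mul_of_nonneg_right hU ht0.le
  have h4 : ∑ i ∈ U, z (x i) < S.card * (diversityPower J β - ε) := hlt
  nlinarith

lemma exists_signalLaw_energy_lt_le {J : ℕ} (hJ : 1 ≤ J) {β ε : ℝ} (hβ0 : 0 < β) (hβ1 : β < 1)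
    (hε : 0 < ε) :
    ∃ C : ℝ, ∀ (n : ℕ) (S : Finset (Fin n)), 0 < S.card →
      signalLaw n J {X | ∃ U ⊆ S, β * S.card ≤ U.card ∧
        ∑ i ∈ U, 1 / (J : ℝ) * ∑ j, X j i ^ 2 < S.card * (diversityPower J β - ε)} ≤
      ENNReal.ofReal (C / S.card) := by
  obtain ⟨C, hC⟩ := exists_measure_energy_lt_le hJ hβ0 hβ1 hε
  refine ⟨C, fun n S hS => le_trans ?_ (hC n S hS)⟩
  have h := measurePreserving_swap_signal n J
  conv_rhs => rw [← h.map_eq]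
  exact Measure.le_map_apply h.measurable.aemeasurable _

lemma exists_signalLaw_single_energy_lt_le (J : ℕ) {β ε : ℝ} (hβ0 : 0 < β) (hβ1 : β < 1)
    (hε : 0 < ε) :
    ∃ C : ℝ, ∀ (n : ℕ) (S : Finset (Fin n)), 0 < S.card →
      signalLaw n J {X | ∃ j, ∃ U ⊆ S, β * S.card ≤ U.card ∧
        ∑ i ∈ U, X j i ^ 2 < S.card * (diversityPower 1 β - ε)} ≤
      ENNReal.ofReal (C / S.card) := by
  obtain ⟨C, hC⟩ := exists_measure_energy_lt_le le_rfl hβ0 hβ1 hε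
  refine ⟨J * C, fun n S hS => ?_⟩
  have hset : {X : Fin J → Fin n → ℝ | ∃ j, ∃ U ⊆ S, β * S.card ≤ U.card ∧
      ∑ i ∈ U, X j i ^ 2 < S.card * (diversityPower 1 β - ε)} =
      ⋃ j, (fun (X : Fin J → Fin n → ℝ) (i : Fin n) (_ : Fin 1) => X j i) ⁻¹'
        {x | ∃ U ⊆ S, β * S.card ≤ U.card ∧ ∑ i ∈ U, 1 / ((1 : ℕ) : ℝ) * ∑ j, x i j ^ 2 <
          S.card * (diversityPower 1 β - ε)} := by
    ext X
    simp
  rw [hset]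
  refine (measure_iUnion_fintype_le _ _).trans ((Finset.sum_le_card_nsmul _ _
    (ENNReal.ofReal (C / S.card)) fun j _ => ?_).trans_eq ?_)
  · have h1 : MeasurePreserving (fun (x : ℝ) (_ : Fin 1) => x) (gaussianReal 0 1) (gaussianVec 1) :=
      (measurePreserving_funUnique (gaussianReal 0 1) (Fin 1)).symm
    have h : MeasurePreserving (fun (X : Fin J → Fin n → ℝ) (i : Fin n) (_ : Fin 1) => X j i)
        (signalLaw n J) (Measure.pi fun _ : Fin n => gaussianVec 1) :=
      (measurePreserving_pi (fun _ : Fin n => gaussianReal 0 1) (fun _ => gaussianVec 1)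
        fun _ => h1).comp (measurePreserving_eval (fun _ : Fin J => gaussianVec n) j)
    refine le_trans ?_ (hC n S hS)
    conv_rhs => rw [← h.map_eq]
    exact Measure.le_map_apply h.measurable.aemeasurable _
  · rw [Finset.card_univ, Fintype.card_fin, nsmul_eq_mul, ← ENNReal.ofReal_natCast,
      ← ENNReal.ofReal_mul (by positivity)]
    congr 1
    ring

end OrderStatistics

/-! ### Counting the competing patterns -/

section Counting

lemma choose_le_exp_binEntropy (n k : ℕ) :
    (n.choose k : ℝ) ≤ Real.exp (n * Real.binEntropy (k / n)) := by
  rcases lt_trichotomy n k with h | rfl | h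
  · rw [Nat.choose_eq_zero_of_lt h, Nat.cast_zero]
    exact (Real.exp_pos _).le
  · rw [Nat.choose_self, Nat.cast_one]
    rcases Nat.eq_zero_or_pos n with rfl | hn
    · simp
    · rw [div_self (by positivity)]; simp
  rcases Nat.eq_zero_or_pos k with rfl | hk
  · simp
  have hn : (0 : ℝ) < n := by exact_mod_cast hk.trans h
  have hkr : (0 : ℝ) < k := by exact_mod_cast hk
  have hknr : (k : ℝ) < n := by exact_mod_cast h
  set p : ℝ := k / n with hp
  have hp0 : 0 < p := div_pos hkr hn
  have hp1 : 0 < 1 - p := by rw [sub_pos, hp, div_lt_one hn]; exact hknr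
  -- a single term of the binomial expansion of `(p + (1 - p)) ^ n = 1` is at most `1`
  have h1 : (n.choose k : ℝ) * (p ^ k * (1 - p) ^ (n - k)) ≤ 1 := by
    have hsum := add_pow p (1 - p) n
    rw [add_sub_cancel, one_pow] at hsum
    refine le_trans (le_of_eq (by ring)) ((Finset.single_le_sum
      (f := fun i => p ^ i * (1 - p) ^ (n - i) * (n.choose i : ℝ)) (fun i _ => by positivity)
      (Finset.mem_range.2 (by omega : k < n + 1))).trans_eq hsum.symm)
  have h2 : p ^ k * (1 - p) ^ (n - k) = Real.exp (-(n * Real.binEntropy p)) := by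
    rw [← Real.exp_log (pow_pos hp0 k), ← Real.exp_log (pow_pos hp1 (n - k)), ← Real.exp_add,
      Real.log_pow, Real.log_pow, Nat.cast_sub h.le, Real.binEntropy, Real.log_inv, Real.log_inv]
    have h3 : (k : ℝ) = n * p := by rw [hp]; field_simp
    congr 1
    rw [h3]; ring
  rw [h2, Real.exp_neg, ← div_eq_mul_inv, div_le_one (Real.exp_pos _)] at h1
  exact h1

lemma card_patterns_le {n k : ℕ} {S : Finset (Fin n)} (hS : S.card = k) (b : ℕ) :
    (Finset.univ.filter fun T : Finset (Fin n) => T.card = k ∧ (S \ T).card = b).card ≤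
      k.choose b * (n - k).choose b := by
  have hc : Sᶜ.card = n - k := by rw [Finset.card_compl, Fintype.card_fin, hS]
  rw [← hc, ← hS, ← Finset.card_powersetCard, ← Finset.card_powersetCard, ← Finset.card_product]
  refine Finset.card_le_card_of_injOn (fun T => (S \ T, T \ S)) ?_ ?_
  · intro T hT
    have hT' : T.card = S.card ∧ (S \ T).card = b := by
      simpa using hT
    have h2 : (T \ S).card = b := by
      rw [← hT'.2]; exact Finset.card_sdiff_comm hT'.1
    simp only [Finset.coe_product, Set.mem_prod, Finset.mem_coe, Finset.mem_powersetCard]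
    refine ⟨⟨Finset.sdiff_subset, hT'.2⟩, fun i hi => ?_, h2⟩
    exact Finset.mem_compl.2 (Finset.mem_sdiff.1 hi).2
  · intro T _ T' _ h
    simp only [Prod.mk.injEq] at h
    ext i
    have h1 := Finset.ext_iff.1 h.1 i
    have h2 := Finset.ext_iff.1 h.2 i
    simp only [Finset.mem_sdiff] at h1 h2
    tauto

/-- The number of patterns at a given distance from `S` grows at most at the exponential rate
`H_b(κ) - R(κ, β)`. -/
lemma exists_pattern_rate {κ β₀ : ℝ} (hκ : κ < 1) :
    ∃ Λ : ℝ → ℝ → ℝ, ContinuousAt (fun v : ℝ × ℝ => Λ v.1 v.2) (κ, β₀) ∧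
      Λ κ β₀ = Real.binEntropy κ - entropyRate κ β₀ ∧
      ∀ (n k b : ℕ) (S : Finset (Fin n)), 0 < k → k < n → S.card = k →
        ((Finset.univ.filter fun T : Finset (Fin n) => T.card = k ∧ (S \ T).card = b).card : ℝ) ≤
          Real.exp (n * Λ (k / n) (b / k)) := by
  by_cases hβ : β₀ < 1 - κ
  · refine ⟨fun x y => x * Real.binEntropy y + (1 - x) * Real.binEntropy (x * y / (1 - x)),
      ?_, ?_, ?_⟩
    · have h1 : (fun v : ℝ × ℝ => (1 - v.1)) (κ, β₀) ≠ 0 := by simp; linarith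
      have h2 : ContinuousAt (fun v : ℝ × ℝ => v.1 * v.2 / (1 - v.1)) (κ, β₀) :=
        ContinuousAt.div (by fun_prop) (by fun_prop) h1
      have h3 : ContinuousAt (fun v : ℝ × ℝ => Real.binEntropy (v.1 * v.2 / (1 - v.1))) (κ, β₀) :=
        ContinuousAt.comp (g := Real.binEntropy) Real.binEntropy_continuous.continuousAt h2
      have h4 : ContinuousAt (fun v : ℝ × ℝ => v.1 * Real.binEntropy v.2) (κ, β₀) := by fun_prop
      have h5 : ContinuousAt (fun v : ℝ × ℝ => 1 - v.1) (κ, β₀) := by fun_prop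
      exact h4.add (h5.mul h3)
    · simp only [entropyRate, if_pos hβ]; ring
    · intro n k b S hk hkn hS
      have hn : (0 : ℝ) < n := by exact_mod_cast hk.trans hkn
      have hkr : (0 : ℝ) < k := by exact_mod_cast hk
      have hknr : (0 : ℝ) < n - k := by rw [sub_pos]; exact_mod_cast hkn
      have h1 : ((Finset.univ.filter fun T : Finset (Fin n) =>
          T.card = k ∧ (S \ T).card = b).card : ℝ) ≤ (k.choose b : ℝ) * ((n - k).choose b : ℝ) := by
        exact_mod_cast card_patterns_le hS b
      refine h1.trans ((mul_le_mul (choose_le_exp_binEntropy _ _) (choose_le_exp_binEntropy _ _)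
        (by positivity) (by positivity)).trans_eq ?_)
      rw [← Real.exp_add, Nat.cast_sub hkn.le]
      have h3 : (k : ℝ) / n * (b / k) / (1 - k / n) = b / (n - k) := by field_simp
      beta_reduce
      rw [h3]
      congr 1
      field_simp
  · refine ⟨fun x _ => Real.binEntropy x, by fun_prop, ?_, ?_⟩
    · simp [entropyRate, if_neg hβ]
    · intro n k b S hk hkn hS
      refine le_trans ?_ (choose_le_exp_binEntropy n k)
      have : (Finset.univ.filter fun T : Finset (Fin n) => T.card = k ∧ (S \ T).card = b).card ≤
          (Finset.powersetCard k (Finset.univ : Finset (Fin n))).card := by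
        refine Finset.card_le_card fun T hT => ?_
        rw [Finset.mem_filter] at hT
        exact Finset.mem_powersetCard.2 ⟨Finset.subset_univ _, hT.2.1⟩
      rw [Finset.card_powersetCard, Finset.card_univ, Fintype.card_fin] at this
      exact_mod_cast this

/-- The union bound over the competing patterns, arranged by their distance to `S`. -/
lemma sum_patterns_le {n k : ℕ} (S : Finset (Fin n)) (N : Set ℝ) [DecidablePred (· ∈ N)]
    (f : Finset (Fin n) → ENNReal) (Λ φ : ℝ → ℝ) (η : ℝ)
    (hΛ : ∀ b : ℕ, ((Finset.univ.filter fun T : Finset (Fin n) =>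
      T.card = k ∧ (S \ T).card = b).card : ℝ) ≤ Real.exp (n * Λ (b / k)))
    (hf : ∀ T : Finset (Fin n), T.card = k → ((S \ T).card : ℝ) / k ∈ N →
      f T ≤ ENNReal.ofReal (Real.exp (n * φ ((S \ T).card / k))))
    (hη : ∀ b : ℕ, (b : ℝ) / k ∈ N → Λ (b / k) + φ (b / k) ≤ -η) :
    ∑ T ∈ Finset.univ.filter (fun T : Finset (Fin n) => T.card = k ∧ ((S \ T).card : ℝ) / k ∈ N),
      f T ≤ ENNReal.ofReal ((n + 1) * Real.exp (-η) ^ n) := by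
  classical
  have hmaps : ∀ T ∈ Finset.univ.filter
      (fun T : Finset (Fin n) => T.card = k ∧ ((S \ T).card : ℝ) / k ∈ N),
      (S \ T).card ∈ Finset.range (n + 1) := by
    intro T _
    have := Finset.card_le_univ (S \ T)
    rw [Fintype.card_fin] at this
    exact Finset.mem_range.2 (by omega)
  rw [← Finset.sum_fiberwise_of_maps_to hmaps]
  have hfib : ∀ b ∈ Finset.range (n + 1), ∑ T ∈ (Finset.univ.filter
      (fun T : Finset (Fin n) => T.card = k ∧ ((S \ T).card : ℝ) / k ∈ N)).filter
        (fun T => (S \ T).card = b), f T ≤ ENNReal.ofReal (Real.exp (-η) ^ n) := by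
    intro b _
    by_cases hb : (b : ℝ) / k ∈ N
    · have hle : ∀ T ∈ (Finset.univ.filter
          (fun T : Finset (Fin n) => T.card = k ∧ ((S \ T).card : ℝ) / k ∈ N)).filter
          (fun T => (S \ T).card = b), f T ≤ ENNReal.ofReal (Real.exp (n * φ (b / k))) := by
        intro T hT
        simp only [Finset.mem_filter, Finset.mem_univ, true_and] at hT
        have := hf T hT.1.1 hT.1.2
        rwa [hT.2] at this
      refine (Finset.sum_le_card_nsmul _ _ _ hle).trans ?_
      rw [nsmul_eq_mul, ← ENNReal.ofReal_natCast, ← ENNReal.ofReal_mul (by positivity)]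
      refine ENNReal.ofReal_le_ofReal ?_
      have hcard : (((Finset.univ.filter
          (fun T : Finset (Fin n) => T.card = k ∧ ((S \ T).card : ℝ) / k ∈ N)).filter
          (fun T => (S \ T).card = b)).card : ℝ) ≤ Real.exp (n * Λ (b / k)) := by
        refine le_trans ?_ (hΛ b)
        refine Nat.cast_le.2 (Finset.card_le_card fun T hT => ?_)
        simp only [Finset.mem_filter, Finset.mem_univ, true_and] at hT ⊢
        exact ⟨hT.1.1, hT.2⟩
      refine (mul_le_mul_of_nonneg_right hcard (Real.exp_pos _).le).trans ?_
      rw [← Real.exp_add, ← Real.exp_nat_mul, ← mul_add]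
      exact Real.exp_le_exp.2 (mul_le_mul_of_nonneg_left (hη b hb) (Nat.cast_nonneg n))
    · rw [Finset.sum_eq_zero]
      · exact bot_le
      · intro T hT
        simp only [Finset.mem_filter, Finset.mem_univ, true_and] at hT
        rw [hT.2] at hT
        exact absurd hT.1.2 hb
  refine (Finset.sum_le_card_nsmul _ _ _ hfib).trans_eq ?_
  rw [Finset.card_range, nsmul_eq_mul, ← ENNReal.ofReal_natCast,
    ← ENNReal.ofReal_mul (by positivity)]
  push_cast
  rfl

lemma tendsto_ofReal_mul_exp_pow {η : ℝ} (hη : 0 < η) :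
    Tendsto (fun n : ℕ => ENNReal.ofReal ((n + 1) * Real.exp (-η) ^ n)) atTop (𝓝 0) := by
  rw [← ENNReal.ofReal_zero]
  refine ENNReal.tendsto_ofReal ?_
  have hr : |Real.exp (-η)| < 1 := by
    rw [abs_of_pos (Real.exp_pos _), Real.exp_lt_one_iff]; linarith
  have h1 := tendsto_pow_const_mul_const_pow_of_abs_lt_one 1 hr
  have h2 := tendsto_pow_const_mul_const_pow_of_abs_lt_one 0 hr
  simpa [add_mul] using h1.add h2

end Counting

/-! ### The exponents -/

section Exponent

variable {κ β : ℝ} {J : ℕ}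

lemma entropyRate_le_binEntropy (hκ : 0 < κ) (hκ' : κ < 1 / 2) (h0 : 0 ≤ β) (h1 : β ≤ 1) :
    entropyRate κ β ≤ Real.binEntropy κ := by
  have hκ1 : 0 < 1 - κ := by linarith
  unfold entropyRate
  split_ifs with h
  · have h2 := Real.binEntropy_nonneg h0 h1
    have h3 : 0 ≤ Real.binEntropy (κ * β / (1 - κ)) := by
      refine Real.binEntropy_nonneg (by positivity) ?_
      rw [div_le_one hκ1]
      nlinarith
    nlinarith [mul_nonneg hκ.le h2, mul_nonneg hκ1.le h3]
  · exact Real.binEntropy_nonneg hκ.le (by linarith)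

lemma log_add_inv_sub_one_pos {x : ℝ} (hx : 0 < x) :
    0 < Real.log (1 + x) + 1 / (1 + x) - 1 := by
  have h := Real.log_lt_sub_one_of_pos (x := (1 + x)⁻¹) (by positivity)
    (by rw [ne_eq, inv_eq_one]; linarith)
  rw [Real.log_inv] at h
  rw [one_div]
  linarith

/-- A strict inequality between exponents extends from `P_J(β₀)` to a slightly smaller power, to
all distortions near `β₀`, and to all nearby sampling rates. -/
lemma exists_uniform_exponent (hJ : 1 ≤ J) {β₀ μ₀ : ℝ} (h0 : 0 < β₀) (h1 : β₀ ≤ 1)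
    {Φ : ℝ → ℝ → ℝ → ℝ → ℝ}
    (hΦ : ContinuousAt (fun v : (ℝ × ℝ) × ℝ × ℝ => Φ v.1.1 v.2.1 v.1.2 v.2.2)
      ((κ, β₀), μ₀, diversityPower J β₀))
    (hneg : Φ κ μ₀ β₀ (diversityPower J β₀) < 0) :
    ∃ η > 0, ∃ δ > 0, ∃ β' ∈ Set.Ioo 0 1, β' < β₀ ∧ ∃ p > 0, p < diversityPower J β' ∧
      ∀ x μ y, |x - κ| < δ → |μ - μ₀| < δ → |y - β₀| < δ → Φ x μ y p ≤ -η := by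
  set η := -Φ κ μ₀ β₀ (diversityPower J β₀) / 2 with hη
  have hη0 : 0 < η := by linarith
  have hev := hΦ.eventually (eventually_lt_nhds
    (show Φ κ μ₀ β₀ (diversityPower J β₀) < -η by linarith))
  obtain ⟨δ, hδ, hball⟩ := Metric.eventually_nhds_iff.1 hev
  have hP0 := diversityPower_pos hJ h0 h1
  -- the power is continuous from the left at `β₀`
  have hleft : Tendsto (diversityPower J) (𝓝[<] β₀) (𝓝 (diversityPower J β₀)) := by
    refine (continuousOn_diversityPower J β₀ ⟨h0.le, h1⟩).mono_left ?_
    rw [← nhdsWithin_Ioo_eq_nhdsLT h0]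
    exact nhdsWithin_mono _ fun y hy => ⟨hy.1.le, hy.2.le.trans h1⟩
  have h4 : ∀ᶠ β' in 𝓝[<] β₀, β' ∈ Set.Ioo 0 β₀ := Ioo_mem_nhdsLT h0
  obtain ⟨β', hβ'1, hβ'2, hβ'3⟩ := (h4.and ((hleft.eventually
    (eventually_gt_nhds (show diversityPower J β₀ - δ / 2 < diversityPower J β₀ by linarith))).and
    (hleft.eventually (eventually_lt_nhds
      (show diversityPower J β₀ < diversityPower J β₀ + δ / 2 by linarith))))).exists
  have hP' := diversityPower_pos hJ hβ'1.1 (hβ'1.2.le.trans h1)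
  refine ⟨η, hη0, δ, hδ, β', ⟨hβ'1.1, hβ'1.2.trans_le h1⟩, hβ'1.2,
    diversityPower J β' - min (δ / 2) (diversityPower J β' / 2), ?_, ?_, ?_⟩
  · have := min_le_right (δ / 2) (diversityPower J β' / 2)
    have h5 : 0 < diversityPower J β' / 2 := by linarith
    change 0 < _
    linarith
  · have : 0 < min (δ / 2) (diversityPower J β' / 2) := lt_min (by linarith) (by linarith)
    linarith
  · intro x μ y hx hμ hy
    have h5 := min_le_left (δ / 2) (diversityPower J β' / 2)
    have h6 : 0 < min (δ / 2) (diversityPower J β' / 2) := lt_min (by linarith) (by linarith)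
    refine (hball (y := ((x, y), μ, _)) ?_).le
    simp only [Prod.dist_eq, max_lt_iff, Real.dist_eq]
    refine ⟨⟨hx, hy⟩, hμ, ?_⟩
    rw [abs_lt]
    constructor <;> linarith

end Exponent

/-! ### Negligible sets of distortions -/

section Negligible

/-- The vectors that are measured when the sparsity pattern is `S`, with their scaling. -/
def scaledSignal {n J : ℕ} (SNR : ℝ) (k : ℕ) (S : Finset (Fin n)) (X : Fin J → Fin n → ℝ) :
    Fin J → Fin n → ℝ :=
  fun j i => √(SNR / k) * if i ∈ S then X j i else 0

/-- The event that, when the sparsity pattern is `S`, some pattern whose relative distance to `S`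
lies in `N` has a cost at most that of `S`. -/
def confusion {n m J : ℕ} (SNR : ℝ) (k : ℕ) (S : Finset (Fin n)) (N : Set ℝ) :
    Set ((Fin J → Fin n → ℝ) × (Fin J → Fin m → Fin n → ℝ) × (Fin J → Fin m → ℝ)) :=
  {ω | ∃ T : Finset (Fin n), T.card = k ∧ ((S \ T).card : ℝ) / k ∈ N ∧
    totalResidual (scaledSignal SNR k S ω.1) T ω.2 ≤
      totalResidual (scaledSignal SNR k S ω.1) S ω.2}

/-- The probability of a confusion at a distance in `N` tends to `0`, uniformly in the sparsity
pattern. -/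
def Negligible (SNR : ℝ) (J : ℕ) (k m : ℕ → ℕ) (N : Set ℝ) : Prop :=
  ∃ ε : ℕ → ENNReal, Tendsto ε atTop (𝓝 0) ∧ ∀ᶠ n in atTop, ∀ S : Finset (Fin n), S.card = k n →
    ((signalLaw n J).prod (channelLaw (m n) n J)) (confusion SNR (k n) S N) ≤ ε n

variable {κ SNR μ₀ β₀ : ℝ} {J : ℕ} {k m : ℕ → ℕ}

lemma confusion_mono {n m J : ℕ} (SNR : ℝ) (k : ℕ) (S : Finset (Fin n)) {M N : Set ℝ}
    (h : M ⊆ N) : confusion (m := m) (J := J) SNR k S M ⊆ confusion SNR k S N :=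
  fun _ ⟨T, hT, hM, hle⟩ => ⟨T, hT, h hM, hle⟩

lemma confusion_union_subset {n m J : ℕ} (SNR : ℝ) (k : ℕ) (S : Finset (Fin n)) (M N : Set ℝ) :
    confusion (m := m) (J := J) SNR k S (M ∪ N) ⊆ confusion SNR k S M ∪ confusion SNR k S N := by
  rintro ω ⟨T, hT, hM | hN, hle⟩
  · exact Or.inl ⟨T, hT, hM, hle⟩
  · exact Or.inr ⟨T, hT, hN, hle⟩

lemma Negligible.mono {M N : Set ℝ} (hMN : M ⊆ N) (h : Negligible SNR J k m N) :
    Negligible SNR J k m M := by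
  obtain ⟨ε, hε, hev⟩ := h
  refine ⟨ε, hε, hev.mono fun n hn S hS => (measure_mono ?_).trans (hn S hS)⟩
  exact confusion_mono _ _ _ hMN

lemma Negligible.union {M N : Set ℝ} (hM : Negligible SNR J k m M) (hN : Negligible SNR J k m N) :
    Negligible SNR J k m (M ∪ N) := by
  obtain ⟨ε, hε, hev⟩ := hM
  obtain ⟨ε', hε', hev'⟩ := hN
  refine ⟨fun n => ε n + ε' n, by simpa using hε.add hε', ?_⟩
  filter_upwards [hev, hev'] with n h1 h2 S hS
  exact (measure_mono (confusion_union_subset _ _ _ _ _)).trans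
    ((measure_union_le _ _).trans (add_le_add (h1 S hS) (h2 S hS)))

lemma negligible_empty : Negligible SNR J k m ∅ := by
  refine ⟨fun _ => 0, tendsto_const_nhds, Eventually.of_forall fun n S _ => ?_⟩
  have : confusion (m := m n) (J := J) SNR (k n) S ∅ = ∅ := by
    ext ω
    simp [confusion]
  rw [this, measure_empty]

lemma measure_prod_le_of_forall {α β : Type*} [MeasurableSpace α] [MeasurableSpace β]
    {μ : Measure α} [IsProbabilityMeasure μ] {ν : Measure β} [SFinite ν] {E : Set (α × β)}
    (hE : MeasurableSet E) {r : ENNReal} (h : ∀ x, ν (Prod.mk x ⁻¹' E) ≤ r) :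
    (μ.prod ν) E ≤ r := by
  rw [Measure.prod_apply hE]
  exact (lintegral_mono h).trans (by simp)

lemma scaledSignal_of_notMem {n : ℕ} {S : Finset (Fin n)} (X : Fin J → Fin n → ℝ) (K : ℕ)
    (j : Fin J) (i : Fin n) (hi : i ∉ S) : scaledSignal SNR K S X j i = 0 := by
  simp [scaledSignal, hi]

lemma sum_sq_scaledSignal (hSNR : 0 ≤ SNR) {n : ℕ} (K : ℕ) (S T : Finset (Fin n))
    (X : Fin J → Fin n → ℝ) (j : Fin J) :
    ∑ i ∈ Tᶜ, scaledSignal SNR K S X j i ^ 2 = SNR / K * ∑ i ∈ S \ T, X j i ^ 2 := by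
  have hsub : S \ T ⊆ Tᶜ := fun i hi => Finset.mem_compl.2 (Finset.mem_sdiff.1 hi).2
  rw [← Finset.sum_subset hsub, Finset.mul_sum]
  · refine Finset.sum_congr rfl fun i hi => ?_
    rw [scaledSignal, if_pos (Finset.mem_sdiff.1 hi).1, mul_pow, Real.sq_sqrt (by positivity)]
  · intro i hi hi'
    have : i ∉ S := fun h => hi' (Finset.mem_sdiff.2 ⟨h, Finset.mem_compl.1 hi⟩)
    rw [scaledSignal_of_notMem X K j i this, sq, zero_mul]

lemma measurable_scaledSignal {n : ℕ} (K : ℕ) (S : Finset (Fin n)) :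
    Measurable (scaledSignal (J := J) SNR K S) := by
  refine measurable_pi_lambda _ fun j => measurable_pi_lambda _ fun i => ?_
  by_cases hi : i ∈ S
  · simp only [scaledSignal, hi, if_true]; fun_prop
  · simp only [scaledSignal, hi, if_false]; fun_prop

lemma measurable_totalResidual_scaledSignal {n M : ℕ} (K : ℕ) (S T : Finset (Fin n)) :
    Measurable fun ω : (Fin J → Fin n → ℝ) × (Fin J → Fin M → Fin n → ℝ) × (Fin J → Fin M → ℝ) =>
      totalResidual (scaledSignal SNR K S ω.1) T ω.2 :=
  measurable_totalResidual T ((measurable_scaledSignal K S).comp measurable_fst) measurable_snd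

lemma eventually_regime (hκ : 0 < κ) (hκ' : κ < 1) (hlt : κ < μ₀)
    (hk : Tendsto (fun n : ℕ => (k n : ℝ) / n) atTop (𝓝 κ))
    (hm : Tendsto (fun n : ℕ => (m n : ℝ) / n) atTop (𝓝 μ₀)) {δ : ℝ} (hδ : 0 < δ) :
    ∀ᶠ n : ℕ in atTop, 0 < k n ∧ k n < n ∧ k n ≤ m n ∧
      |(k n : ℝ) / n - κ| < δ ∧ |(m n : ℝ) / n - μ₀| < δ := by
  filter_upwards [hk.eventually (eventually_gt_nhds hκ), hk.eventually (eventually_lt_nhds hκ'),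
    hk.eventually_lt hm hlt, Metric.tendsto_nhds.1 hk δ hδ, Metric.tendsto_nhds.1 hm δ hδ,
    eventually_gt_atTop 0] with n h1 h2 h3 h4 h5 h6
  have hn : (0 : ℝ) < n := by exact_mod_cast h6
  refine ⟨?_, ?_, ?_, h4, h5⟩
  · rcases Nat.eq_zero_or_pos (k n) with h | h
    · rw [h] at h1; simp at h1
    · exact h
  · rw [div_lt_one hn] at h2; exact_mod_cast h2
  · rw [div_lt_div_iff_of_pos_right hn] at h3
    exact_mod_cast h3.le

lemma tendsto_ofReal_div_card (hκ : 0 < κ)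
    (hk : Tendsto (fun n : ℕ => (k n : ℝ) / n) atTop (𝓝 κ)) (C : ℝ) :
    Tendsto (fun n : ℕ => ENNReal.ofReal (C / k n)) atTop (𝓝 0) := by
  have h : Tendsto (fun n : ℕ => (k n : ℝ)) atTop atTop := by
    refine (hk.pos_mul_atTop hκ tendsto_natCast_atTop_atTop).congr' ?_
    filter_upwards [eventually_gt_atTop 0] with n hn
    have : (n : ℝ) ≠ 0 := by positivity
    field_simp
  rw [← ENNReal.ofReal_zero]
  exact ENNReal.tendsto_ofReal (h.const_div_atTop C)

/-- Near `β₀`, confusions are unlikely when the sampling rate beats `E₁(β₀)`: each competing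
pattern is compared to `S` by a Chernoff bound on the difference of the two costs. -/
lemma exists_negligible_of_E₁ (hκ : 0 < κ) (hκ' : κ < 1 / 2) (hSNR : 0 < SNR) (hJ : 1 ≤ J)
    (h0 : 0 < β₀) (h1 : β₀ ≤ 1)
    (hk : Tendsto (fun n : ℕ => (k n : ℝ) / n) atTop (𝓝 κ))
    (hm : Tendsto (fun n : ℕ => (m n : ℝ) / n) atTop (𝓝 μ₀))
    (hE : E₁ κ SNR J β₀ < J * (μ₀ - κ)) :
    ∃ N ∈ 𝓝 β₀, Negligible SNR J k m N := by
  classical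
  have hJr : (0 : ℝ) < J := by exact_mod_cast hJ
  obtain ⟨Λ, hΛc, hΛ0, hΛ⟩ := exists_pattern_rate (κ := κ) (β₀ := β₀) (by linarith)
  have hP := diversityPower_pos hJ h0 h1
  set P := diversityPower J β₀ with hPdef
  have hnum : 0 ≤
      2 * Real.binEntropy κ - 2 * entropyRate κ β₀ + 2 * β₀ * κ * J * Real.log (5 / 3) := by
    have := entropyRate_le_binEntropy hκ hκ' h0.le h1
    have h2 : 0 ≤ Real.log (5 / 3) := Real.log_nonneg (by norm_num)
    have : 0 ≤ 2 * β₀ * κ * J * Real.log (5 / 3) := by positivity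
    linarith
  have hlog : 0 < Real.log (1 + 4 / 25 * J * P * SNR) :=
    Real.log_pos (by have : 0 < 4 / 25 * J * P * SNR := by positivity
                     linarith)
  have hden : 0 < 1 / (J : ℝ) * Real.log (1 + 4 / 25 * J * P * SNR) := by positivity
  have hlt : κ < μ₀ := by
    have : 0 ≤ E₁ κ SNR J β₀ := div_nonneg hnum hden.le
    have h2 : 0 < J * (μ₀ - κ) := lt_of_le_of_lt this hE
    have := (mul_pos_iff_of_pos_left hJr).1 h2
    linarith
  have hlt' : 0 < μ₀ - κ := by linarith
  rw [E₁, div_lt_iff₀ hden] at hE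
  let Φ : ℝ → ℝ → ℝ → ℝ → ℝ := fun x μ y p =>
    Λ x y + (y * x * J * (Real.log 2 / 2) - (μ - x) / 2 * Real.log (1 + 1 / 4 * (SNR * J * p)))
  have hΦc : ContinuousAt (fun v : (ℝ × ℝ) × ℝ × ℝ => Φ v.1.1 v.2.1 v.1.2 v.2.2)
      ((κ, β₀), μ₀, P) := by
    have h2 : ContinuousAt (fun v : (ℝ × ℝ) × ℝ × ℝ => Λ v.1.1 v.1.2) ((κ, β₀), μ₀, P) :=
      ContinuousAt.comp (f := Prod.fst) (g := fun v : ℝ × ℝ => Λ v.1 v.2) hΛc continuousAt_fst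
    have h3 : ContinuousAt (fun v : (ℝ × ℝ) × ℝ × ℝ => Real.log (1 + 1 / 4 * (SNR * J * v.2.2)))
        ((κ, β₀), μ₀, P) := by
      refine ContinuousAt.log (by fun_prop) ?_
      have : 0 < 1 / 4 * (SNR * J * P) := by positivity
      exact ne_of_gt (by simpa using by linarith)
    have h4 : ContinuousAt (fun v : (ℝ × ℝ) × ℝ × ℝ => v.1.2 * v.1.1 * J * (Real.log 2 / 2))
      ((κ, β₀), μ₀, P) := by fun_prop
    have h5 : ContinuousAt (fun v : (ℝ × ℝ) × ℝ × ℝ => (v.2.1 - v.1.1) / 2)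
      ((κ, β₀), μ₀, P) := by fun_prop
    exact h2.add (h4.sub (h5.mul h3))
  have hΦneg : Φ κ μ₀ β₀ P < 0 := by
    simp only [Φ, hΛ0]
    have h2 : Real.log 2 ≤ 2 * Real.log (5 / 3) := by
      rw [← Real.log_rpow (by norm_num)]
      exact Real.log_le_log (by norm_num) (by norm_num)
    have h3 : Real.log (1 + 4 / 25 * J * P * SNR) ≤ Real.log (1 + 1 / 4 * (SNR * J * P)) := by
      refine Real.log_le_log (by positivity) ?_
      have : 0 < SNR * J * P := by positivity
      nlinarith
    have h4 : β₀ * κ * J * Real.log 2 ≤ β₀ * κ * J * (2 * Real.log (5 / 3)) :=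
      mul_le_mul_of_nonneg_left h2 (by positivity)
    have h5 := mul_le_mul_of_nonneg_left h3 hlt'.le
    have h6 : J * (μ₀ - κ) * (1 / J * Real.log (1 + 4 / 25 * J * P * SNR)) =
        (μ₀ - κ) * Real.log (1 + 4 / 25 * J * P * SNR) := by field_simp
    rw [h6] at hE
    linarith
  obtain ⟨η, hη, δ, hδ, β', hβ', hβ'0, p, hp0, hp, hΦle⟩ :=
    exists_uniform_exponent hJ h0 h1 hΦc hΦneg
  obtain ⟨C, hC⟩ := exists_signalLaw_energy_lt_le hJ hβ'.1 hβ'.2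
    (ε := diversityPower J β' - p) (by linarith)
  refine ⟨{y | β' < y ∧ |y - β₀| < δ}, ?_, ?_⟩
  · filter_upwards [eventually_gt_nhds hβ'0, Metric.ball_mem_nhds β₀ hδ] with y hy1 hy2
    exact ⟨hy1, hy2⟩
  set N : Set ℝ := {y | β' < y ∧ |y - β₀| < δ}
  refine ⟨fun n => ENNReal.ofReal (C / k n) + ENNReal.ofReal ((n + 1) * Real.exp (-η) ^ n),
    by simpa using (tendsto_ofReal_div_card hκ hk C).add (tendsto_ofReal_mul_exp_pow hη), ?_⟩
  filter_upwards [eventually_regime hκ (by linarith) hlt hk hm hδ] with n hn S hS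
  obtain ⟨hk0, hkn, hkm, hx, hμ⟩ := hn
  set K := k n
  set M := m n
  have hn0 : (0 : ℝ) < n := by exact_mod_cast hk0.trans hkn
  have hK0 : (0 : ℝ) < K := by exact_mod_cast hk0
  let G : Finset (Fin n) →
      Set ((Fin J → Fin n → ℝ) × (Fin J → Fin M → Fin n → ℝ) × (Fin J → Fin M → ℝ)) :=
    fun T => {ω | K * p ≤ ∑ i ∈ S \ T, 1 / (J : ℝ) * ∑ j, ω.1 j i ^ 2} ∩
      {ω | totalResidual (scaledSignal SNR K S ω.1) T ω.2 ≤
        totalResidual (scaledSignal SNR K S ω.1) S ω.2}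
  have hGm : ∀ T, MeasurableSet (G T) := fun T =>
    (measurableSet_le measurable_const (by fun_prop)).inter
      (measurableSet_le (measurable_totalResidual_scaledSignal K S T)
        (measurable_totalResidual_scaledSignal K S S))
  let B : Set (Fin J → Fin n → ℝ) := {X | ∃ U ⊆ S, β' * S.card ≤ U.card ∧
    ∑ i ∈ U, 1 / (J : ℝ) * ∑ j, X j i ^ 2 <
      S.card * (diversityPower J β' - (diversityPower J β' - p))}
  have hsub : confusion (m := M) SNR K S N ⊆ B ×ˢ Set.univ ∪
      ⋃ T ∈ Finset.univ.filter (fun T : Finset (Fin n) => T.card = K ∧ ((S \ T).card : ℝ) / K ∈ N),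
        G T := by
    rintro ω ⟨T, hT, hTN, hle⟩
    by_cases hB : ω.1 ∈ B
    · exact Or.inl ⟨hB, trivial⟩
    · refine Or.inr (Set.mem_biUnion (x := T) (by simpa using ⟨hT, hTN⟩) ⟨?_, hle⟩)
      simp only [Set.mem_ofPred_eq]
      by_contra hlow
      refine hB ⟨S \ T, Finset.sdiff_subset, ?_, ?_⟩
      · rw [hS]; exact ((lt_div_iff₀ hK0).1 hTN.1).le
      · rw [hS, sub_sub_cancel]; exact not_le.1 hlow
  refine (measure_mono hsub).trans ((measure_union_le _ _).trans (add_le_add ?_ ?_))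
  · rw [Measure.prod_prod, measure_univ, mul_one]
    refine (hC n S (hS ▸ hk0)).trans_eq ?_
    rw [hS]
  · refine (measure_biUnion_finset_le _ _).trans ?_
    refine sum_patterns_le S N _ (fun y => Λ (K / n) y)
      (fun y => y * (K / n) * J * (Real.log 2 / 2) -
      ((M : ℝ) / n - K / n) / 2 * Real.log (1 + 1 / 4 * (SNR * J * p))) η
      (fun b => hΛ n K b S hk0 hkn hS) ?_ (fun b hb => hΦle _ _ _ hx hμ hb.2)
    intro T hT hTN
    have hq : 0 ≤ SNR * J * p := by positivity
    refine measure_prod_le_of_forall (r := ENNReal.ofReal (Real.exp (n *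
      ((S \ T).card / K * (K / n) *
      J * (Real.log 2 / 2) - ((M : ℝ) / n - K / n) / 2 * Real.log (1 + 1 / 4 * (SNR * J * p))))))
      (hGm T) fun X => ?_
    by_cases hX : K * p ≤ ∑ i ∈ S \ T, 1 / (J : ℝ) * ∑ j, X j i ^ 2
    · refine (measure_mono fun ω hω => hω.2).trans ((channelLaw_totalResidual_le
        (c := scaledSignal SNR K S X) T (fun j i hi => scaledSignal_of_notMem X K j i hi)
        (hT ▸ hkm) hq ?_).trans (ENNReal.ofReal_le_ofReal ?_))
      · simp_rw [sum_sq_scaledSignal hSNR.le]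
        rw [← Finset.mul_sum, Finset.sum_comm]
        rw [← Finset.mul_sum] at hX
        have h2 : 0 < SNR * J / K := by positivity
        have h3 := mul_le_mul_of_nonneg_left hX h2.le
        have h4 : SNR * J / K * (K * p) = SNR * J * p := by field_simp
        have h5 : ∀ s : ℝ, SNR * J / K * (1 / J * s) = SNR / K * s := fun s => by field_simp
        rwa [h4, h5] at h3
      · have h2 : (T \ S).card = (S \ T).card := Finset.card_sdiff_comm (hT.trans hS.symm)
        have h3 : 0 < 1 + 1 / 4 * (SNR * J * p) := by positivity
        rw [h2, hT, Real.rpow_def_of_pos (by norm_num), Real.rpow_def_of_pos h3, ← Real.exp_add]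
        refine (congrArg Real.exp ?_).le
        field_simp
        ring
    · have : Prod.mk X ⁻¹' G T = ∅ := by
        ext ω
        simp only [G, Set.mem_preimage, Set.mem_inter_iff, Set.mem_ofPred_eq,
          Set.mem_empty_iff_false, iff_false]
        exact fun h => hX h.1
      rw [this, measure_empty]
      exact bot_le

/-- Near `β₀`, confusions are unlikely when the sampling rate beats `E₂(β₀)`: the cost of `S`
concentrates at `J (m - k)`, and the cost of a competing pattern is unlikely to be that small. -/
lemma exists_negligible_of_E₂ (hκ : 0 < κ) (hκ' : κ < 1 / 2) (hSNR : 0 < SNR) (hJ : 1 ≤ J)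
    (h0 : 0 < β₀) (h1 : β₀ ≤ 1)
    (hk : Tendsto (fun n : ℕ => (k n : ℝ) / n) atTop (𝓝 κ))
    (hm : Tendsto (fun n : ℕ => (m n : ℝ) / n) atTop (𝓝 μ₀))
    (hE : E₂ κ SNR β₀ < J * (μ₀ - κ)) :
    ∃ N ∈ 𝓝 β₀, Negligible SNR J k m N := by
  classical
  have hJr : (0 : ℝ) < J := by exact_mod_cast hJ
  obtain ⟨Λ, hΛc, hΛ0, hΛ⟩ := exists_pattern_rate (κ := κ) (β₀ := β₀) (by linarith)
  have hP := diversityPower_pos le_rfl h0 h1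
  set P := diversityPower 1 β₀ with hPdef
  set q₀ := P * SNR with hq₀
  have hq₀0 : 0 < q₀ := by positivity
  have hnum : 0 ≤ 2 * Real.binEntropy κ - 2 * entropyRate κ β₀ := by
    have := entropyRate_le_binEntropy hκ hκ' h0.le h1
    linarith
  have hden := log_add_inv_sub_one_pos hq₀0
  have hlt : κ < μ₀ := by
    have : 0 ≤ E₂ κ SNR β₀ := div_nonneg hnum hden.le
    have h2 : 0 < J * (μ₀ - κ) := lt_of_le_of_lt this hE
    have := (mul_pos_iff_of_pos_left hJr).1 h2
    linarith
  have hlt' : 0 < μ₀ - κ := by linarith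
  rw [E₂, div_lt_iff₀ hden] at hE
  -- the tilting parameter that is optimal for the lower tail of a chi-square variable
  set s := q₀ / (2 * (1 + q₀)) with hs
  have hs0 : 0 < s := by positivity
  have hs1 : 2 * s = 1 - 1 / (1 + q₀) := by rw [hs]; field_simp; ring
  have hs2 : 1 + 2 * s * (1 + q₀) = 1 + q₀ := by rw [hs]; field_simp
  set gap := -(Λ κ β₀ + J * (μ₀ - κ) * (s - 1 / 2 * Real.log (1 + q₀))) with hgap
  have hgap0 : 0 < gap := by
    have h2 : s - 1 / 2 * Real.log (1 + q₀) =
      -(1 / 2) * (Real.log (1 + q₀) + 1 / (1 + q₀) - 1) := by linarith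
    rw [hgap, hΛ0, h2]
    linarith
  set e := gap / (2 * (J * (μ₀ - κ) * s)) with he
  have he0 : 0 < e := by positivity
  let Φ : ℝ → ℝ → ℝ → ℝ → ℝ := fun x μ y p =>
    Λ x y + J * (μ - x) * (s * (1 + e) - 1 / 2 * Real.log (1 + 2 * s * (1 + SNR * p)))
  have hΦc : ContinuousAt (fun v : (ℝ × ℝ) × ℝ × ℝ => Φ v.1.1 v.2.1 v.1.2 v.2.2)
      ((κ, β₀), μ₀, P) := by
    have h2 : ContinuousAt (fun v : (ℝ × ℝ) × ℝ × ℝ => Λ v.1.1 v.1.2) ((κ, β₀), μ₀, P) :=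
      ContinuousAt.comp (f := Prod.fst) (g := fun v : ℝ × ℝ => Λ v.1 v.2) hΛc continuousAt_fst
    have h3 : ContinuousAt (fun v : (ℝ × ℝ) × ℝ × ℝ =>
        Real.log (1 + 2 * s * (1 + SNR * v.2.2))) ((κ, β₀), μ₀, P) := by
      refine ContinuousAt.log (by fun_prop) ?_
      exact ne_of_gt (show 0 < 1 + 2 * s * (1 + SNR * P) by positivity)
    have h4 : ContinuousAt (fun v : (ℝ × ℝ) × ℝ × ℝ => (J : ℝ) * (v.2.1 - v.1.1))
      ((κ, β₀), μ₀, P) := by fun_prop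
    exact h2.add (h4.mul (continuousAt_const.sub (continuousAt_const.mul h3)))
  have hΦneg : Φ κ μ₀ β₀ P < 0 := by
    simp only [Φ]
    rw [mul_comm SNR P, ← hq₀, hs2]
    have h2 : J * (μ₀ - κ) * s * e = gap / 2 := by rw [he]; field_simp
    have h3 : Λ κ β₀ + J * (μ₀ - κ) * (s * (1 + e) - 1 / 2 * Real.log (1 + q₀)) =
        J * (μ₀ - κ) * s * e - gap := by rw [hgap]; ring
    rw [h3, h2]
    linarith
  obtain ⟨η, hη, δ', hδ', β', hβ', hβ'0, p, hp0, hp, hΦle⟩ :=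
    exists_uniform_exponent le_rfl h0 h1 hΦc hΦneg
  obtain ⟨C, hC⟩ := exists_signalLaw_single_energy_lt_le J hβ'.1 hβ'.2
    (ε := diversityPower 1 β' - p) (by linarith)
  set δ := min δ' ((μ₀ - κ) / 4) with hδdef
  have hδ : 0 < δ := lt_min hδ' (by linarith)
  -- the exponent of the upper tail of the cost of `S`
  set a := (e - Real.log (1 + e)) / 2 with ha
  have ha0 : 0 < a := by
    have := Real.log_lt_sub_one_of_pos (x := 1 + e) (by linarith) (by linarith)
    rw [ha]; linarith
  set t := e / (2 * (1 + e)) with ht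
  have ht0 : 0 < t := by positivity
  have ht1 : 1 - 2 * t = (1 + e)⁻¹ := by rw [ht]; field_simp; ring
  have ht2 : t < 1 / 2 := by
    have : 0 < (1 + e)⁻¹ := by positivity
    linarith
  have ht3 : t * (1 + e) = e / 2 := by rw [ht]; field_simp
  set η' := J * ((μ₀ - κ) / 2) * a with hη'
  have hη'0 : 0 < η' := by positivity
  refine ⟨{y | β' < y ∧ |y - β₀| < δ}, ?_, ?_⟩
  · filter_upwards [eventually_gt_nhds hβ'0, Metric.ball_mem_nhds β₀ hδ] with y hy1 hy2
    exact ⟨hy1, hy2⟩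
  set N : Set ℝ := {y | β' < y ∧ |y - β₀| < δ}
  refine ⟨fun n => ENNReal.ofReal (C / k n) + (ENNReal.ofReal ((n + 1) * Real.exp (-η') ^ n) +
    ENNReal.ofReal ((n + 1) * Real.exp (-η) ^ n)),
    by
      simpa using (tendsto_ofReal_div_card hκ hk C).add
        ((tendsto_ofReal_mul_exp_pow hη'0).add (tendsto_ofReal_mul_exp_pow hη)), ?_⟩
  filter_upwards [eventually_regime hκ (by linarith) hlt hk hm hδ] with n hn S hS
  obtain ⟨hk0, hkn, hkm, hx, hμ⟩ := hn
  set K := k n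
  set M := m n
  have hn0 : (0 : ℝ) < n := by exact_mod_cast hk0.trans hkn
  have hK0 : (0 : ℝ) < K := by exact_mod_cast hk0
  set thr : ℝ := J * ((M : ℝ) - K) * (1 + e) with hthr
  let G : Finset (Fin n) →
      Set ((Fin J → Fin n → ℝ) × (Fin J → Fin M → Fin n → ℝ) × (Fin J → Fin M → ℝ)) :=
    fun T => (⋂ j, {ω | K * p ≤ ∑ i ∈ S \ T, ω.1 j i ^ 2}) ∩
      {ω | totalResidual (scaledSignal SNR K S ω.1) T ω.2 ≤ thr}
  have hGm : ∀ T, MeasurableSet (G T) := fun T =>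
    (MeasurableSet.iInter fun j => measurableSet_le measurable_const (by fun_prop)).inter
      (measurableSet_le (measurable_totalResidual_scaledSignal K S T) measurable_const)
  let B : Set (Fin J → Fin n → ℝ) := {X | ∃ j, ∃ U ⊆ S, β' * S.card ≤ U.card ∧
    ∑ i ∈ U, X j i ^ 2 < S.card * (diversityPower 1 β' - (diversityPower 1 β' - p))}
  let D : Set ((Fin J → Fin n → ℝ) × (Fin J → Fin M → Fin n → ℝ) × (Fin J → Fin M → ℝ)) :=
    {ω | thr ≤ totalResidual (scaledSignal SNR K S ω.1) S ω.2}
  have hDm : MeasurableSet D :=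
    measurableSet_le measurable_const (measurable_totalResidual_scaledSignal K S S)
  have hsub : confusion (m := M) SNR K S N ⊆ B ×ˢ Set.univ ∪ (D ∪
      ⋃ T ∈ Finset.univ.filter (fun T : Finset (Fin n) => T.card = K ∧ ((S \ T).card : ℝ) / K ∈ N),
        G T) := by
    rintro ω ⟨T, hT, hTN, hle⟩
    by_cases hB : ω.1 ∈ B
    · exact Or.inl ⟨hB, trivial⟩
    by_cases hD : ω ∈ D
    · exact Or.inr (Or.inl hD)
    · refine Or.inr (Or.inr (Set.mem_biUnion (x := T) (by simpa using ⟨hT, hTN⟩)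
        ⟨Set.mem_iInter.2 fun j => ?_, hle.trans (not_le.1 hD).le⟩))
      simp only [Set.mem_ofPred_eq]
      by_contra hlow
      refine hB ⟨j, S \ T, Finset.sdiff_subset, ?_, ?_⟩
      · rw [hS]; exact ((lt_div_iff₀ hK0).1 hTN.1).le
      · rw [hS, sub_sub_cancel]; exact not_le.1 hlow
  refine (measure_mono hsub).trans ((measure_union_le _ _).trans (add_le_add ?_
    ((measure_union_le _ _).trans (add_le_add ?_ ?_))))
  · rw [Measure.prod_prod, measure_univ, mul_one]
    refine (hC n S (hS ▸ hk0)).trans_eq ?_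
    rw [hS]
  · refine measure_prod_le_of_forall hDm fun X => ?_
    refine (channelLaw_le_totalResidual (c := scaledSignal SNR K S X)
      (fun j i hi => scaledSignal_of_notMem X K j i hi) (hS ▸ hkm) ht0.le ht2 thr).trans
      (ENNReal.ofReal_le_ofReal ?_)
    have h2 : 0 < 1 - 2 * t := by linarith
    rw [Real.rpow_def_of_pos h2, ht1, Real.log_inv, ← Real.exp_add, hS, ← Real.exp_nat_mul]
    have h3 : -(t * thr) + -Real.log (1 + e) * (-(J * ((M : ℝ) - K)) / 2) =
        -(J * ((M : ℝ) - K) * a) := by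
      have : t * thr = J * ((M : ℝ) - K) * (e / 2) := by rw [hthr, ← ht3]; ring
      rw [this, ha]; ring
    rw [h3]
    have h4 : n * ((μ₀ - κ) / 2) ≤ (M : ℝ) - K := by
      have h5 : (μ₀ - κ) / 2 ≤ (M : ℝ) / n - K / n := by
        have h6 := (abs_lt.1 hx).2
        have h7 := (abs_lt.1 hμ).1
        have h8 : δ ≤ (μ₀ - κ) / 4 := min_le_right _ _
        linarith
      rw [← sub_div, le_div_iff₀ hn0] at h5
      linarith
    have h5 : Real.exp (-(J * ((M : ℝ) - K) * a)) ≤ Real.exp (n * -η') := by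
      refine Real.exp_le_exp.2 ?_
      have := mul_le_mul_of_nonneg_left h4 (show 0 ≤ J * a by positivity)
      rw [hη']
      linarith
    refine h5.trans (le_mul_of_one_le_left (Real.exp_pos _).le (by linarith))
  · refine (measure_biUnion_finset_le _ _).trans ?_
    refine sum_patterns_le S N _ (fun y => Λ (K / n) y) (fun _ => J * ((M : ℝ) / n - K / n) *
      (s * (1 + e) - 1 / 2 * Real.log (1 + 2 * s * (1 + SNR * p)))) η
      (fun b => hΛ n K b S hk0 hkn hS) ?_ (fun b hb => hΦle _ _ _ (hx.trans_le (min_le_left _ _))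
        (hμ.trans_le (min_le_left _ _)) (hb.2.trans_le (min_le_left _ _)))
    intro T hT hTN
    have hq : 0 ≤ SNR * p := by positivity
    refine measure_prod_le_of_forall (r := ENNReal.ofReal (Real.exp (n *
      (J * ((M : ℝ) / n - K / n) *
      (s * (1 + e) - 1 / 2 * Real.log (1 + 2 * s * (1 + SNR * p))))))) (hGm T) fun X => ?_
    by_cases hX : ∀ j, K * p ≤ ∑ i ∈ S \ T, X j i ^ 2
    · refine (measure_mono fun ω hω => hω.2).trans ((channelLaw_totalResidual_le_const
        (scaledSignal SNR K S X) T (hT ▸ hkm) hs0.le hq (fun j => ?_) thr).trans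
          (ENNReal.ofReal_le_ofReal ?_))
      · rw [sum_sq_scaledSignal hSNR.le]
        have h3 := mul_le_mul_of_nonneg_left (hX j) (show 0 ≤ SNR / K by positivity)
        have h4 : SNR / K * (K * p) = SNR * p := by field_simp
        rwa [h4] at h3
      · have h3 : 0 < 1 + 2 * s * (1 + SNR * p) := by positivity
        rw [hT, Real.rpow_def_of_pos h3, ← Real.exp_add]
        refine (congrArg Real.exp ?_).le
        rw [hthr]
        field_simp
        ring
    · have : Prod.mk X ⁻¹' G T = ∅ := by
        ext ω
        simp only [G, Set.mem_preimage, Set.mem_inter_iff, Set.mem_iInter, Set.mem_ofPred_eq,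
          Set.mem_empty_iff_false, iff_false]
        exact fun h => hX h.1
      rw [this, measure_empty]
      exact bot_le

end Negligible

/-! ### Vanishing distortion -/

/-- Both bounds are infinite in the limit `β → 0`: their numerators are of order `β log (1 / β)`,
their denominators at most of order `β`. -/
lemma exists_lt_E₁_and_lt_E₂ {κ SNR : ℝ} {J : ℕ} (hκ : 0 < κ) (hκ' : κ < 1 / 2) (hSNR : 0 < SNR)
    (hJ : 1 ≤ J) (B : ℝ) :
    ∃ β ∈ Set.Icc (0 : ℝ) 1, B < E₁ κ SNR J β ∧ B < E₂ κ SNR β := by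
  have hJr : (0 : ℝ) < J := by exact_mod_cast hJ
  set c := max (chiSqQuantile J (1 / 2)) (chiSqQuantile 1 (1 / 2)) with hc
  have hc0 : 0 < c := lt_max_of_lt_left (chiSqQuantile_pos hJ (by norm_num) (by norm_num))
  -- `L` is `log (1 / β)`
  set L : ℝ := max 1 (SNR * c * (|B| + 1) / (2 * κ)) with hL
  have hL1 : 1 ≤ L := le_max_left _ _
  have hLB : B * (SNR * c) < 2 * κ * L := by
    have h1 : SNR * c * (|B| + 1) / (2 * κ) ≤ L := le_max_right _ _
    rw [div_le_iff₀ (by positivity)] at h1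
    have h2 : B * (SNR * c) < (|B| + 1) * (SNR * c) :=
      mul_lt_mul_of_pos_right (by linarith [le_abs_self B]) (by positivity)
    linarith
  set β := Real.exp (-L) with hβ
  have hβ0 : 0 < β := Real.exp_pos _
  have hβ2 : β < 1 / 2 := by
    have h1 : β ≤ Real.exp (-1) := Real.exp_le_exp.2 (by linarith)
    exact h1.trans_lt (Real.exp_neg_one_lt_half.trans_eq (by norm_num))
  have hnum : 2 * κ * L * β ≤ 2 * Real.binEntropy κ - 2 * entropyRate κ β := by
    rw [entropyRate, if_pos (by linarith)]
    have h1 : 0 ≤ Real.binEntropy (κ * β / (1 - κ)) := by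
      have h2 : 0 < 1 - κ := by linarith
      refine Real.binEntropy_nonneg (by positivity) ?_
      rw [div_le_one h2]
      nlinarith
    have h3 : L * β ≤ Real.binEntropy β := by
      have h4 : 0 ≤ Real.log (1 - β)⁻¹ :=
        Real.log_nonneg (one_le_inv₀ (by linarith) |>.2 (by linarith))
      have h5 : Real.log β⁻¹ = L := by rw [Real.log_inv, hβ, Real.log_exp, neg_neg]
      have h6 := mul_nonneg (show 0 ≤ 1 - β by linarith) h4
      rw [Real.binEntropy, h5]
      linarith
    have h7 := mul_le_mul_of_nonneg_left h3 hκ.le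
    have h8 : 0 ≤ (1 - κ) * Real.binEntropy (κ * β / (1 - κ)) := mul_nonneg (by linarith) h1
    linarith
  have hPle : ∀ I : ℕ, 1 ≤ I → chiSqQuantile I (1 / 2) ≤ c → diversityPower I β * SNR ≤
      SNR * c * β := by
    intro I hI hIc
    have h1 := diversityPower_le_mul hI hβ0.le (by linarith : β < 1)
    have h2 := monotoneOn_chiSqQuantile hI (a := β) (b := 1 / 2) ⟨hβ0.le, by linarith⟩
      ⟨by norm_num, by norm_num⟩ hβ2.le
    have h3 : β * chiSqQuantile I β ≤ β * c := mul_le_mul_of_nonneg_left (h2.trans hIc) hβ0.le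
    have h4 := mul_le_mul_of_nonneg_right (h1.trans h3) hSNR.le
    linarith
  have key : ∀ num den : ℝ, 2 * κ * L * β ≤ num → 0 < den → den ≤ SNR * c * β → B < num / den := by
    intro num den h1 h2 h3
    have h4 : 2 * κ * L * β / (SNR * c * β) ≤ num / den :=
      div_le_div₀ (le_trans (by positivity) h1) h1 h2 h3
    refine lt_of_lt_of_le ?_ h4
    rw [lt_div_iff₀ (by positivity), ← mul_assoc]
    exact mul_lt_mul_of_pos_right hLB hβ0
  refine ⟨β, ⟨hβ0.le, by linarith⟩, key _ _ ?_ ?_ ?_, key _ _ hnum ?_ ?_⟩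
  · have h2 : 0 ≤ Real.log (5 / 3) := Real.log_nonneg (by norm_num)
    have : 0 ≤ 2 * β * κ * J * Real.log (5 / 3) := by positivity
    linarith
  · have hP := diversityPower_pos hJ hβ0 (by linarith)
    refine mul_pos (by positivity) (Real.log_pos ?_)
    have : 0 < 4 / 25 * J * diversityPower J β * SNR := by positivity
    linarith
  · have hP := diversityPower_pos hJ hβ0 (by linarith)
    refine le_trans ?_ (hPle J hJ (le_max_left _ _))
    have h1 := Real.log_le_sub_one_of_pos
      (show 0 < 1 + 4 / 25 * J * diversityPower J β * SNR by positivity)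
    have h2 := mul_le_mul_of_nonneg_left h1 (show 0 ≤ 1 / (J : ℝ) by positivity)
    refine h2.trans ?_
    have h3 : 1 / (J : ℝ) * (1 + 4 / 25 * J * diversityPower J β * SNR - 1) =
        4 / 25 * (diversityPower J β * SNR) := by field_simp; ring
    rw [h3]
    have : 0 < diversityPower J β * SNR := by positivity
    linarith
  · exact log_add_inv_sub_one_pos (mul_pos (diversityPower_pos le_rfl hβ0 (by linarith)) hSNR)
  · have hP := mul_pos (diversityPower_pos le_rfl hβ0 (by linarith)) hSNR
    refine le_trans ?_ (hPle 1 le_rfl (le_max_right _ _))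
    have h1 := Real.log_le_sub_one_of_pos (show 0 < 1 + diversityPower 1 β * SNR by linarith)
    have h2 : 1 / (1 + diversityPower 1 β * SNR) ≤ 1 := by
      rw [div_le_one (by linarith)]; linarith
    linarith

/-! ### From confusions to the error probability -/

section ErrorProb

variable {n m J : ℕ}

lemma cost_eq_totalResidual (SNR : ℝ) (k : ℕ) (ω : Sample n m J) (T : Finset (Fin n)) :
    cost (measurement SNR k ω) (sensing ω) T =
      totalResidual (scaledSignal SNR k ω.1 ω.2.1) T ω.2.2 := by
  refine Finset.sum_congr rfl fun j _ => ?_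
  have : measurement SNR k ω j =
      observe (scaledSignal SNR k ω.1 ω.2.1 j) (ω.2.2.1 j) (ω.2.2.2 j) := by
    have h : scaledSignal SNR k ω.1 ω.2.1 j = √(SNR / k) • signal ω j := rfl
    rw [measurement, observe, h, Matrix.mulVec_smul]
    rfl
  rw [this]
  rfl

/-- The distortion exceeds `α` only if the sparsity pattern is confused with another one at a
distance in `[α, 1]`. -/
lemma mem_confusion_of_lt_distortion {SNR α : ℝ} {k : ℕ} {est : Estimator n m J}
    (hest : IsNearestSubspace k est) {ω : Sample n m J} (hω : ω.1.card = k)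
    (h : α < distortion k (pattern ω) (est (measurement SNR k ω) (sensing ω))) :
    ω.2 ∈ confusion SNR k ω.1 (Set.Icc α 1) := by
  obtain ⟨hcard, hmin⟩ := hest (measurement SNR k ω) (sensing ω)
  set T := est (measurement SNR k ω) (sensing ω)
  refine ⟨T, hcard, ⟨?_, ?_⟩, ?_⟩
  · have h1 : (T \ ω.1).card = (ω.1 \ T).card := Finset.card_sdiff_comm (hcard.trans hω.symm)
    rw [distortion, pattern, h1, max_self] at h
    exact h.le
  · refine div_le_one_of_le₀ ?_ (Nat.cast_nonneg k)
    rw [← hω]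
    exact_mod_cast Finset.card_le_card Finset.sdiff_subset
  · rw [← cost_eq_totalResidual, ← cost_eq_totalResidual]
    exact hmin ω.1 hω

lemma errorProb_le {SNR α : ℝ} {k : ℕ} (hk : k ≤ n) {est : Estimator n m J}
    (hest : IsNearestSubspace k est) {r : ENNReal}
    (hr : ∀ S : Finset (Fin n), S.card = k →
      ((signalLaw n J).prod (channelLaw m n J)) (confusion SNR k S (Set.Icc α 1)) ≤ r) :
    errorProb SNR α k est ≤ r := by
  classical
  set s : Set (Finset (Fin n)) := {S | S.card = k} with hs
  have hne : s.Nonempty := by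
    obtain ⟨S, -, hS⟩ := Finset.exists_subset_card_eq
      (s := (Finset.univ : Finset (Fin n))) (by simpa using hk)
    exact ⟨S, hS⟩
  have hprob : IsProbabilityMeasure (uniformOn s) := isProbabilityMeasure_uniformOn s.toFinite hne
  have hcompl : uniformOn s sᶜ = 0 := by
    rw [prob_compl_eq_zero_iff s.toFinite.measurableSet]
    exact uniformOn_self s.toFinite hne
  let F : Finset (Finset (Fin n)) := Finset.univ.filter fun S => S.card = k
  have hsub : {ω : Sample n m J | α < distortion k (pattern ω)
      (est (measurement SNR k ω) (sensing ω))} ⊆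
      sᶜ ×ˢ Set.univ ∪ ⋃ S ∈ F, {S} ×ˢ confusion SNR k S (Set.Icc α 1) := by
    intro ω hω
    by_cases h : ω.1.card = k
    · exact Or.inr (Set.mem_biUnion (x := ω.1) (by simpa [F] using h)
        ⟨rfl, mem_confusion_of_lt_distortion hest h hω⟩)
    · exact Or.inl ⟨h, trivial⟩
  refine (measure_mono hsub).trans ((measure_union_le _ _).trans ?_)
  rw [law, Measure.prod_prod, hcompl, zero_mul, zero_add]
  refine (measure_biUnion_finset_le _ _).trans ?_
  calc ∑ S ∈ F, ((uniformOn s).prod ((signalLaw n J).prod (channelLaw m n J)))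
        ({S} ×ˢ confusion SNR k S (Set.Icc α 1))
      ≤ ∑ S ∈ F, uniformOn s {S} * r := by
        refine Finset.sum_le_sum fun S hS => ?_
        rw [Measure.prod_prod]
        exact mul_le_mul_right (hr S (Finset.mem_filter.1 hS).2) _
    _ = uniformOn s F * r := by rw [← Finset.sum_mul, sum_measure_singleton]
    _ ≤ 1 * r := mul_le_mul_left prob_le_one _
    _ = r := one_mul r

end ErrorProb

end SparsityRecovery

end

theorem theorem1 (κ SNR ρ α : ℝ) (J : ℕ) (hκ : 0 < κ) (hκ' : κ < 1 / 2) (hSNR : 0 < SNR)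
    (hJ : 1 ≤ J) (hα : 0 ≤ α)
    (hρ : ((κ * J : ℝ) : EReal) +
        ⨆ β ∈ Set.Icc α 1,
          ((min (SparsityRecovery.E₁ κ SNR J β) (SparsityRecovery.E₂ κ SNR β) : ℝ) : EReal)
      < (ρ : EReal)) :
    SparsityRecovery.NearestSubspaceAchievable κ SNR ρ J α := by
  open SparsityRecovery in
  have hJr : (0 : ℝ) < J := by exact_mod_cast hJ
  have hmin : ∀ β ∈ Set.Icc α 1, min (E₁ κ SNR J β) (E₂ κ SNR β) < J * (ρ / J - κ) := by
    intro β hβ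
    have h1 : ((min (E₁ κ SNR J β) (E₂ κ SNR β) : ℝ) : EReal) ≤
        ⨆ β ∈ Set.Icc α 1, ((min (E₁ κ SNR J β) (E₂ κ SNR β) : ℝ) : EReal) :=
      le_iSup₂ (f := fun (β : ℝ) (_ : β ∈ Set.Icc α 1) =>
        ((min (E₁ κ SNR J β) (E₂ κ SNR β) : ℝ) : EReal)) β hβ
    have h2 := (add_le_add_right h1 ((κ * J : ℝ) : EReal)).trans_lt hρ
    rw [← EReal.coe_add, EReal.coe_lt_coe_iff] at h2
    have h3 : J * (ρ / J - κ) = ρ - κ * J := by field_simp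
    linarith
  -- for `α = 0` the supremum is infinite
  have hα0 : 0 < α := by
    refine lt_of_le_of_ne hα fun h => ?_
    obtain ⟨β, hβ, h1, h2⟩ := exists_lt_E₁_and_lt_E₂ hκ hκ' hSNR hJ (J * (ρ / J - κ))
    rw [h] at hβ
    exact absurd (hmin β hβ) (not_lt.2 (le_min h1.le h2.le))
  intro k m hkn hk hm est hest
  have hneg : Negligible SNR J k m (Set.Icc α 1) := by
    refine isCompact_Icc.induction_on (p := Negligible SNR J k m) negligible_empty
      (fun _ _ h h' => h'.mono h) (fun _ _ h h' => h.union h') fun β hβ => ?_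
    have h0 : 0 < β := hα0.trans_le hβ.1
    rcases min_lt_iff.1 (hmin β hβ) with h | h
    · obtain ⟨N, hN, hneg⟩ := exists_negligible_of_E₁ hκ hκ' hSNR hJ h0 hβ.2 hk hm h
      exact ⟨N, mem_nhdsWithin_of_mem_nhds hN, hneg⟩
    · obtain ⟨N, hN, hneg⟩ := exists_negligible_of_E₂ hκ hκ' hSNR hJ h0 hβ.2 hk hm h
      exact ⟨N, mem_nhdsWithin_of_mem_nhds hN, hneg⟩
  obtain ⟨ε, hε, hev⟩ := hneg
  refine tendsto_of_tendsto_of_tendsto_of_le_of_le' tendsto_const_nhds hε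
    (Eventually.of_forall fun _ => bot_le) ?_
  filter_upwards [hev] with n hn
  exact errorProb_le (hkn n) (hest n) hn
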